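/- Let $n\ge 2$, $p\ge 0$, $m=n+p$, and let $\Sigma$ be a smooth $n$-dimensional manifold smoothly embedded in a smooth $m$-dimensional Riemannian manifold $(M,\bar g)$; let $g$ be the induced metric on $\Sigma$. Let $x^1,\dots,x^m$ and $u^1,\dots,u^n$ be local coordinates on $M$ and $\Sigma$, regard $x^i=x^i(u^1,\dots,u^n)$ as the embedding functions, and write $\partial_a=\partial/\partial u^a$, $e_a=(\partial_a x^i)\,\partial_i$ and $g_{ab}=\bar g(e_a,e_b)$ (repeated indices are summed). Let $N_1,\dots,N_p$ be a smooth local orthonormal frame of the normal bundle of $\Sigma$, and let $\bar\nabla$ be the Levi-Civita connection of $M$. Let $\rho$ be a non-vanishing density on $\Sigma$ (given by a non-vanishing function in the coordinates $u$), and define the Nambu bracket $$\{f_1,\dots,f_n\}=\frac1\rho\,\varepsilon^{a_1\cdots a_n}(\partial_{a_1}f_1)\cdots(\partial_{a_n}f_n),\qquad \gamma=\frac{\sqrt{\det(g_{ab})}}{\rho}.$$ For multi-indices $I=i_1\cdots i_{n-1}$ and $J=j_1\cdots j_{n-1}$ put $\bar g_{IJ}=\bar g_{i_1j_1}\cdots\bar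 g_{i_{n-1}j_{n-1}}$ and $$\mathcal P^{iJ}=\frac{1}{\sqrt{(n-1)!}}\{x^i,x^{j_1},\dots,x^{j_{n-1}}\},\qquad \mathcal T_A^{Ij}=\frac{(-1)^n}{\sqrt{(n-1)!}}\,\frac{\varepsilon^{a_1\cdots a_{n-1}a}}{\rho}(\partial_{a_1}x^{i_1})\cdots(\partial_{a_{n-1}}x^{i_{n-1}})(\bar\nabla_{e_a}N_A)^j,$$ $$(\mathcal P^2)^{ik}=\mathcal P^{iI}\mathcal P^{kJ}\bar g_{IJ},\qquad (\mathcal B_A)^{ik}=\mathcal P^{iI}\mathcal T_A^{Jk}\bar g_{IJ}.$$ Regard $\mathcal B_A$ as the linear map $TM\to TM$, $\mathcal B_A(X)^i=(\mathcal B_A)^{ik}\bar g_{kj}X^j$, with trace $\operatorname{Tr}\mathcal B_A$. Let $\bar R(X,Y)Z=\bar\nabla_X\bar\nabla_YZ-\bar\nabla_Y\bar\nabla_XZ-\bar\nabla_{[X,Y]}Z$ and $\bar R_{ijkl}=\bar g(\bar R(\partial_k,\partial_l)\partial_j,\partial_i)$, and define the curvature $R(X,Y)Z$ of $(\Sigma,g)$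 by the same convention. Let $\mathcal R:T\Sigma\to T\Sigma$ be the Ricci map of $\Sigma$, $\mathcal R^q_b=g^{ac}g^{qd}\,g(R(e_c,e_d)e_b,e_a)$, and let $R=\mathcal R^b_b$ be the scalar curvature. Then, at every point of $\Sigma$ where these data are defined and for every $X\in T\Sigma$, $$\mathcal R(X)=\frac1{\gamma^4}(\mathcal P^2)^{ik}(\mathcal P^2)^{lr}\bar R_{ijkl}X^j\,\partial_r+\frac1{\gamma^4}\sum_{A=1}^p\Big[(\operatorname{Tr}\mathcal B_A)\,\mathcal B_A(X)-\mathcal B_A^2(X)\Big],$$ $$R=\frac1{\gamma^4}(\mathcal P^2)^{ik}(\mathcal P^2)^{jl}\bar R_{ijkl}+\frac1{\gamma^4}\sum_{A=1}^p\Big[(\operatorname{Tr}\mathcal B_A)^2-\operatorname{Tr}(\mathcal B_A^2)\Big].$$ -/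

import Mathlib

open scoped Manifold ContDiff Bundle

noncomputable section

namespace NambuGeometry

/-! ### Riemannian geometry in local coordinates

Coordinates range over `EuclideanSpace ℝ (Fin n)`; a metric in coordinates is a matrix-valued
function `G` with entries `G u i j`. -/

/-- The partial derivative `∂ₐ f` at `u`. -/
def pd {n : ℕ} (f : EuclideanSpace ℝ (Fin n) → ℝ) (a : Fin n)
    (u : EuclideanSpace ℝ (Fin n)) : ℝ :=
  fderiv ℝ f u (EuclideanSpace.single a 1)

/-- The Christoffel symbol `Γ^i_{jk}` of the metric `G`. -/
def christoffel {n : ℕ} (G : EuclideanSpace ℝ (Fin n) → Matrix (Fin n) (Fin n) ℝ)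
    (i j k : Fin n) (u : EuclideanSpace ℝ (Fin n)) : ℝ :=
  (1 / 2) * ∑ l, (G u)⁻¹ i l *
    (pd (fun v => G v l k) j u + pd (fun v => G v l j) k u - pd (fun v => G v j k) l u)

/-- `i`-th component of `R(∂ₖ, ∂ₗ) ∂ⱼ`, where `R(X,Y)Z = ∇_X ∇_Y Z - ∇_Y ∇_X Z - ∇_{[X,Y]} Z`
for the Levi-Civita connection `∇` of `G`. -/
def riemannUp {n : ℕ} (G : EuclideanSpace ℝ (Fin n) → Matrix (Fin n) (Fin n) ℝ)
    (i j k l : Fin n) (u : EuclideanSpace ℝ (Fin n)) : ℝ :=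
  pd (christoffel G i l j) k u - pd (christoffel G i k j) l u
    + ∑ s, (christoffel G i k s u * christoffel G s l j u
      - christoffel G i l s u * christoffel G s k j u)

/-- The curvature tensor `R_{ijkl} = g(R(∂ₖ, ∂ₗ) ∂ⱼ, ∂ᵢ)`. -/
def riemann {n : ℕ} (G : EuclideanSpace ℝ (Fin n) → Matrix (Fin n) (Fin n) ℝ)
    (i j k l : Fin n) (u : EuclideanSpace ℝ (Fin n)) : ℝ :=
  ∑ s, G u i s * riemannUp G s j k l u

/-- The mixed components `ℛ^p_b = g^{ac} g^{pd} g(R(∂_c, ∂_d) ∂_b, ∂_a)` of the Ricci curvature. -/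
def ricciMatrix {n : ℕ} (G : EuclideanSpace ℝ (Fin n) → Matrix (Fin n) (Fin n) ℝ)
    (u : EuclideanSpace ℝ (Fin n)) : Matrix (Fin n) (Fin n) ℝ :=
  Matrix.of fun p b => ∑ a, ∑ c, ∑ d, (G u)⁻¹ a c * (G u)⁻¹ p d * riemann G a b c d u

/-! ### Passing between a manifold and its charts -/

section Charts

variable {m : ℕ} {M : Type*} [TopologicalSpace M] [ChartedSpace (EuclideanSpace ℝ (Fin m)) M]

/-- The `i`-th component, in the chart `φ`, of a vector tangent to `M` at `y`. -/
def comp (φ : OpenPartialHomeomorph M (EuclideanSpace ℝ (Fin m))) (y : M)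
    (v : TangentSpace (𝓡 m) y) (i : Fin m) : ℝ :=
  (show EuclideanSpace ℝ (Fin m) from mfderiv (𝓡 m) (𝓡 m) φ y v) i

/-- The coordinate vector `∂ᵢ` of the chart `φ` at `y`. -/
def coordVec (φ : OpenPartialHomeomorph M (EuclideanSpace ℝ (Fin m))) (y : M) (i : Fin m) :
    TangentSpace (𝓡 m) y :=
  (mfderiv (𝓡 m) (𝓡 m) φ y).inverse
    (show TangentSpace (𝓡 m) (φ y) from EuclideanSpace.single i (1 : ℝ))

/-- The linear map `v ↦ Aⁱⱼ vʲ ∂ᵢ` of the tangent space at `y`, in the chart `φ`. -/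
def tangentEnd (φ : OpenPartialHomeomorph M (EuclideanSpace ℝ (Fin m))) (y : M)
    (A : Matrix (Fin m) (Fin m) ℝ) (v : TangentSpace (𝓡 m) y) : TangentSpace (𝓡 m) y :=
  ∑ i, (∑ j, A i j * comp φ y v j) • coordVec φ y i

/-- The components `g_{ij} = g(∂ᵢ, ∂ⱼ)` in the chart `φ`, as functions of the coordinates. -/
def metricInChart (φ : OpenPartialHomeomorph M (EuclideanSpace ℝ (Fin m)))
    (g : (y : M) → TangentSpace (𝓡 m) y → TangentSpace (𝓡 m) y → ℝ)
    (u : EuclideanSpace ℝ (Fin m)) : Matrix (Fin m) (Fin m) ℝ :=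
  Matrix.of fun i j => g (φ.symm u) (coordVec φ (φ.symm u) i) (coordVec φ (φ.symm u) j)

/-- The Ricci curvature at `y`, as a map of the tangent space, computed in the chart `φ`. -/
def ricciMap (φ : OpenPartialHomeomorph M (EuclideanSpace ℝ (Fin m)))
    (g : (y : M) → TangentSpace (𝓡 m) y → TangentSpace (𝓡 m) y → ℝ)
    (y : M) (v : TangentSpace (𝓡 m) y) : TangentSpace (𝓡 m) y :=
  tangentEnd φ y (ricciMatrix (metricInChart φ g) (φ y)) v

/-- The scalar curvature at `y`, computed in the chart `φ`. -/
def scalarCurvature (φ : OpenPartialHomeomorph M (EuclideanSpace ℝ (Fin m)))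
    (g : (y : M) → TangentSpace (𝓡 m) y → TangentSpace (𝓡 m) y → ℝ) (y : M) : ℝ :=
  (ricciMatrix (metricInChart φ g) (φ y)).trace

variable {n : ℕ} {S : Type*} [TopologicalSpace S] [ChartedSpace (EuclideanSpace ℝ (Fin n)) S]

/-- The metric on `S` induced by `f : S → M`. -/
def inducedMetric (f : S → M)
    (g : (y : M) → TangentSpace (𝓡 m) y → TangentSpace (𝓡 m) y → ℝ) (x : S)
    (v w : TangentSpace (𝓡 n) x) : ℝ :=
  g (f x) (mfderiv (𝓡 n) (𝓡 m) f x v) (mfderiv (𝓡 n) (𝓡 m) f x w)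

/-- The embedding coordinates `xⁱ(u¹, …, uⁿ)`. -/
def embCoord (φ : OpenPartialHomeomorph M (EuclideanSpace ℝ (Fin m)))
    (ψ : OpenPartialHomeomorph S (EuclideanSpace ℝ (Fin n))) (f : S → M)
    (i : Fin m) (u : EuclideanSpace ℝ (Fin n)) : ℝ :=
  φ (f (ψ.symm u)) i

/-- The components `νⁱ(u¹, …, uⁿ)` of a vector field `ν` of `M` along `f : S → M`. -/
def alongCoord (φ : OpenPartialHomeomorph M (EuclideanSpace ℝ (Fin m)))
    (ψ : OpenPartialHomeomorph S (EuclideanSpace ℝ (Fin n))) (f : S → M)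
    (ν : (x : S) → TangentSpace (𝓡 m) (f x)) (i : Fin m) (u : EuclideanSpace ℝ (Fin n)) : ℝ :=
  comp φ (f (ψ.symm u)) (ν (ψ.symm u)) i

end Charts

/-! ### Nambu brackets -/

open Classical in
/-- The Levi-Civita symbol. -/
def leviCivita {n : ℕ} (a : Fin n → Fin n) : ℝ :=
  if h : Function.Bijective a then ((Equiv.Perm.sign (Equiv.ofBijective a h) : ℤ) : ℝ) else 0

/-- The Nambu bracket `{f₁, …, fₙ} = ρ⁻¹ ε^{a₁⋯aₙ} (∂_{a₁} f₁) ⋯ (∂_{aₙ} fₙ)`. -/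
def nambu {n : ℕ} (ρ : EuclideanSpace ℝ (Fin n) → ℝ)
    (f : Fin n → EuclideanSpace ℝ (Fin n) → ℝ) (u : EuclideanSpace ℝ (Fin n)) : ℝ :=
  (1 / ρ u) * ∑ a : Fin n → Fin n, leviCivita a * ∏ s, pd (f s) (a s) u

/-! In what follows the submanifold has dimension `d + 1`, so that multi-indices have length `d`.
Its embedding coordinates are `x i`, the ambient metric in coordinates is `G`, and `ν i` are the
components of a vector field along the submanifold. -/

section Tensors

variable {d m : ℕ} (G : EuclideanSpace ℝ (Fin m) → Matrix (Fin m) (Fin m) ℝ)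
  (ρ : EuclideanSpace ℝ (Fin (d + 1)) → ℝ)
  (x ν : Fin m → EuclideanSpace ℝ (Fin (d + 1)) → ℝ)

/-- `(∇̄ₐ ν)^j = ∂ₐ ν^j + Γ̄^j_{kl} (∂ₐ x^k) ν^l`, the ambient covariant derivative along `∂ₐ`. -/
def covDerivAlong (a : Fin (d + 1)) (j : Fin m) (u : EuclideanSpace ℝ (Fin (d + 1))) : ℝ :=
  pd (ν j) a u
    + ∑ k, ∑ l, christoffel G j k l (WithLp.toLp 2 fun i => x i u) * pd (x k) a u * ν l u

/-- `ḡ_{IJ} = ḡ_{i₁j₁} ⋯ ḡ_{i_d j_d}` at the point with coordinates `x i u`. -/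
def multiMetric (I J : Fin d → Fin m) (u : EuclideanSpace ℝ (Fin (d + 1))) : ℝ :=
  ∏ s, G (WithLp.toLp 2 fun i => x i u) (I s) (J s)

/-- `𝒫^{iJ} = {x^i, x^{j₁}, …, x^{j_d}} / √d!`. -/
def tensorP (i : Fin m) (J : Fin d → Fin m) (u : EuclideanSpace ℝ (Fin (d + 1))) : ℝ :=
  (1 / √(d.factorial : ℝ)) * nambu ρ (Fin.cons (x i) fun s => x (J s)) u

/-- `𝒯^{Ij} = (-1)^{d+1} / √d! · ρ⁻¹ ε^{a₁⋯a_d a} (∂_{a₁} x^{i₁}) ⋯ (∂_{a_d} x^{i_d}) (∇̄ₐ ν)^j`. -/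
def tensorT (I : Fin d → Fin m) (j : Fin m) (u : EuclideanSpace ℝ (Fin (d + 1))) : ℝ :=
  ((-1) ^ (d + 1) / √(d.factorial : ℝ)) *
    ∑ b : Fin d → Fin (d + 1), ∑ a : Fin (d + 1),
      leviCivita (Fin.snoc (α := fun _ => Fin (d + 1)) b a) / ρ u
        * (∏ s, pd (x (I s)) (b s) u) * covDerivAlong G x ν a j u

/-- `(𝒫²)^{ik} = 𝒫^{iI} 𝒫^{kJ} ḡ_{IJ}`. -/
def tensorP2 (u : EuclideanSpace ℝ (Fin (d + 1))) (i k : Fin m) : ℝ :=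
  ∑ I : Fin d → Fin m, ∑ J : Fin d → Fin m,
    tensorP ρ x i I u * tensorP ρ x k J u * multiMetric G x I J u

/-- `ℬ^{ik} = 𝒫^{iI} 𝒯^{Jk} ḡ_{IJ}`. -/
def tensorB (u : EuclideanSpace ℝ (Fin (d + 1))) (i k : Fin m) : ℝ :=
  ∑ I : Fin d → Fin m, ∑ J : Fin d → Fin m,
    tensorP ρ x i I u * tensorT G ρ x ν J k u * multiMetric G x I J u

/-- `ℬ^i_j = ℬ^{ik} ḡ_{kj}`, the matrix of `ℬ` as a map of the ambient tangent space. -/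
def mixedB (u : EuclideanSpace ℝ (Fin (d + 1))) : Matrix (Fin m) (Fin m) ℝ :=
  Matrix.of fun i j => ∑ k, tensorB G ρ x ν u i k * G (WithLp.toLp 2 fun i => x i u) k j

end Tensors

end NambuGeometry

end

noncomputable section

namespace NambuGeometry

open Matrix Filter Topology

/-! ### Contractions of the Levi-Civita symbol -/

/-! Write n = d + 1, let E be the Jacobian of the embedding, Ḡ the ambient metric along it, and g =
Eᵀ Ḡ E. In both 𝒫² and ℬ_A two Levi-Civita symbols are contracted through ḡ_{IJ} with d factors of E
on either side, hence with d copies of g. Such a contraction is d! det(g) g⁻¹ up to transposition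
(`sum_leviCivita_leviCivita_prod`), so the brackets collapse: 𝒫² = γ² E g⁻¹ Eᵀ and ℬ_A = -γ² E g⁻¹
(∇̄N_A)ᵀ Ḡ (`tensorP2_eq`, `mixedB_eq`). The first is γ² times the tangential projection with an
index raised. Differentiating ḡ(N_A, e_a) = 0 identifies -(∇̄N_A)ᵀ Ḡ E with the second fundamental
form h_A (`secondForm_apply`), so ℬ_A E = γ² E g⁻¹ h_A: on tangent vectors ℬ_A is γ² times the
Weingarten map. Moreover ℬ_A = E Z with Z E = γ² g⁻¹ h_A, so by cyclicity the traces of ℬ_A and ℬ_A²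
are those of the Weingarten map up to powers of γ².

The theorem is thus the Gauss equation, contracted to Ricci and scalar curvature. That equation is
obtained along the embedding: the commutator of covariant derivatives gives the ambient curvature
(`covDerivAlong_commutator`), and differentiating the Koszul formula for g expresses the tangential
component of ∇̄_c ∇̄_e e_b through the intrinsic Christoffel symbols and a normal remainder
(`innerAlong_tangentAlong_covDerivAlong_tangentDeriv`). Since the e_a and N_A together number d + 1
+ p, they span (`completeness`), and the remainder becomes a sum of products of the h_A
(`normalPart_eq`).

The matrix identities `jac_mul_ricciMatrix` and `trace_ricciMatrix` pass to the manifolds by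
comparing components in charts. The embedding being an immersion makes g positive definite, so γ ≠ 0
and γ² = det(g) / ρ². -/

lemma leviCivita_perm {n : ℕ} (σ : Equiv.Perm (Fin n)) :
    leviCivita σ = ((Equiv.Perm.sign σ : ℤ) : ℝ) := by
  have : Equiv.ofBijective σ σ.bijective = σ := Equiv.ext fun _ => rfl
  rw [leviCivita, dif_pos σ.bijective, this]

lemma leviCivita_of_not_bijective {n : ℕ} {a : Fin n → Fin n} (h : ¬ Function.Bijective a) :
    leviCivita a = 0 := by
  rw [leviCivita, dif_neg h]

lemma leviCivita_sq {n : ℕ} {a : Fin n → Fin n} (h : Function.Bijective a) :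
    leviCivita a * leviCivita a = 1 := by
  rw [leviCivita, dif_pos h]
  norm_cast
  rw [← sq, Int.units_sq, Units.val_one]

lemma det_submatrix_eq_leviCivita_mul {n : ℕ} (g : Matrix (Fin n) (Fin n) ℝ)
    (a : Fin n → Fin n) : (g.submatrix a id).det = leviCivita a * g.det := by
  by_cases h : Function.Bijective a
  · have := Matrix.det_permute (Equiv.ofBijective a h) g
    rw [leviCivita, dif_pos h]
    exact this
  · rw [leviCivita_of_not_bijective h, zero_mul]
    have hi : ¬ Function.Injective a := fun hi => h (Finite.injective_iff_bijective.mp hi)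
    simp only [Function.Injective, not_forall] at hi
    obtain ⟨i, j, hij, hne⟩ := hi
    exact Matrix.det_zero_of_row_eq hne (by ext k; simp [hij])

lemma sum_leviCivita_mul_prod {n : ℕ} (g : Matrix (Fin n) (Fin n) ℝ) :
    ∑ b : Fin n → Fin n, leviCivita b * ∏ s, g s (b s) = g.det := by
  classical
  -- The Leibniz formula `Matrix.det_apply'` permutes the row index, whereas here the column index
  -- varies; hence the transpose.
  rw [← Matrix.det_transpose, Matrix.det_apply']
  symm
  refine Finset.sum_bij_ne_zero (fun σ _ _ => (σ : Fin n → Fin n)) (fun _ _ _ => Finset.mem_univ _)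
    (fun σ _ _ τ _ _ h => DFunLike.coe_injective h) (fun b _ hb => ?_) (fun σ _ _ => ?_)
  · have h : Function.Bijective b := by
      by_contra h
      exact hb (by rw [leviCivita_of_not_bijective h, zero_mul])
    refine ⟨Equiv.ofBijective b h, Finset.mem_univ _, ?_, rfl⟩
    rw [leviCivita, dif_pos h] at hb
    exact hb
  · rw [leviCivita_perm]
    rfl

lemma sum_leviCivita_mul_prod_rows {n : ℕ} (g : Matrix (Fin n) (Fin n) ℝ) (a : Fin n → Fin n) :
    ∑ b : Fin n → Fin n, leviCivita b * ∏ s, g (a s) (b s) = leviCivita a * g.det := by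
  rw [← det_submatrix_eq_leviCivita_mul, ← sum_leviCivita_mul_prod]
  rfl

lemma sum_pi_fin_succ {d : ℕ} {α : Type*} [Fintype α] (F : (Fin (d + 1) → α) → ℝ) :
    ∑ b, F b = ∑ b : α, ∑ b' : Fin d → α, F (Fin.cons b b') := by
  rw [← Fintype.sum_prod_type' (f := fun b b' => F (Fin.cons b b'))]
  exact (Fintype.sum_equiv (Fin.consEquiv fun _ => α) _ _ fun _ => rfl).symm

/-- A completion of `a` to a permutation enumerates the complement of `a`, and `a.succAbove` is one
such enumeration. The `d!` completions are counted this way. -/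
lemma cons_bijective_iff {d : ℕ} {a : Fin (d + 1)} {a' : Fin d → Fin (d + 1)} :
    Function.Bijective (Fin.cons a a' : Fin (d + 1) → Fin (d + 1)) ↔
      ∃ σ : Equiv.Perm (Fin d), a' = a.succAbove ∘ σ := by
  rw [← Finite.injective_iff_bijective, Fin.cons_injective_iff]
  constructor
  · rintro ⟨h1, h2⟩
    have h3 : ∀ s, ∃ t, a.succAbove t = a' s := fun s =>
      Fin.exists_succAbove_eq fun h => h1 ⟨s, h⟩
    choose τ hτ using h3
    have hi : Function.Injective τ := fun s t h => h2 (by rw [← hτ s, ← hτ t, h])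
    exact ⟨Equiv.ofBijective τ (Finite.injective_iff_bijective.mp hi), funext fun s => (hτ s).symm⟩
  · rintro ⟨σ, rfl⟩
    exact ⟨by rintro ⟨s, hs⟩; exact Fin.succAbove_ne a _ hs,
      Fin.succAbove_right_injective.comp σ.injective⟩

/-- For `a = c` each of the `d!` completions contributes the square of a sign. For `a ≠ c` no list
completes both indices, since it would have to contain `c` and also avoid it. -/
lemma sum_leviCivita_cons_mul {d : ℕ} (a c : Fin (d + 1)) :
    ∑ a' : Fin d → Fin (d + 1), leviCivita (Fin.cons a a') * leviCivita (Fin.cons c a') =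
      if a = c then (d.factorial : ℝ) else 0 := by
  classical
  split_ifs with h
  · subst h
    have h1 : ∑ a' : Fin d → Fin (d + 1), leviCivita (Fin.cons a a') * leviCivita (Fin.cons a a')
        = ∑ a' ∈ Finset.univ.image (fun σ : Equiv.Perm (Fin d) => a.succAbove ∘ σ), (1 : ℝ) := by
      rw [← Finset.sum_subset (Finset.subset_univ
        (Finset.univ.image (fun σ : Equiv.Perm (Fin d) => a.succAbove ∘ σ)))]
      · refine Finset.sum_congr rfl fun a' ha' => leviCivita_sq (cons_bijective_iff.mpr ?_)
        obtain ⟨σ, -, hσ⟩ := Finset.mem_image.mp ha'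
        exact ⟨σ, hσ.symm⟩
      · intro a' _ ha'
        rw [leviCivita_of_not_bijective, zero_mul]
        intro hb
        obtain ⟨σ, hσ⟩ := cons_bijective_iff.mp hb
        exact ha' (Finset.mem_image.mpr ⟨σ, Finset.mem_univ _, hσ.symm⟩)
    rw [h1, Finset.sum_const, Finset.card_image_of_injective, Finset.card_univ, Fintype.card_perm,
      Fintype.card_fin, nsmul_eq_mul, mul_one]
    intro σ τ hστ
    ext s
    exact congrArg Fin.val (Fin.succAbove_right_injective (congrFun hστ s))
  · refine Finset.sum_eq_zero fun a' _ => ?_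
    by_contra hne
    have h1 : Function.Bijective (Fin.cons a a' : Fin (d + 1) → Fin (d + 1)) := by
      by_contra hb; exact hne (by rw [leviCivita_of_not_bijective hb, zero_mul])
    have h2 : Function.Bijective (Fin.cons c a' : Fin (d + 1) → Fin (d + 1)) := by
      by_contra hb; exact hne (by rw [leviCivita_of_not_bijective hb, mul_zero])
    obtain ⟨s, hs⟩ := h1.surjective c
    refine Fin.cases (fun hs => h hs) (fun t hs => ?_) s hs
    have := h2.injective (a₁ := t.succ) (a₂ := 0) (by simpa using hs)
    exact absurd this (Fin.succ_ne_zero t)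

/-- Two Levi-Civita symbols contracted with `d` copies of `g` give `d!` times the adjugate. -/
lemma sum_leviCivita_leviCivita_prod {d : ℕ} (g : Matrix (Fin (d + 1)) (Fin (d + 1)) ℝ)
    (hg : IsUnit g.det) (a b : Fin (d + 1)) :
    ∑ a' : Fin d → Fin (d + 1), ∑ b' : Fin d → Fin (d + 1),
      leviCivita (Fin.cons a a') * leviCivita (Fin.cons b b') * ∏ s, g (a' s) (b' s) =
        d.factorial * g.det * g⁻¹ b a := by
  set C : Matrix (Fin (d + 1)) (Fin (d + 1)) ℝ := Matrix.of fun a b =>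
    ∑ a' : Fin d → Fin (d + 1), ∑ b' : Fin d → Fin (d + 1),
      leviCivita (Fin.cons a a') * leviCivita (Fin.cons b b') * ∏ s, g (a' s) (b' s) with hC
  -- Multiplying by `gᵀ` supplies the missing factor of `g`: the sum over `b` and `b'` becomes a
  -- full determinant with rows `c, a'`, equal to a sign times `g.det`, and the product of the two
  -- remaining symbols sums to `d!` or zero.
  have key : C * gᵀ = ((d.factorial : ℝ) * g.det) • (1 : Matrix (Fin (d + 1)) (Fin (d + 1)) ℝ) := by
    ext a c
    have h1 : ∀ a' : Fin d → Fin (d + 1), ∑ b : Fin (d + 1), ∑ b' : Fin d → Fin (d + 1),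
        leviCivita (Fin.cons b b') * (g c b * ∏ s, g (a' s) (b' s)) =
          leviCivita (Fin.cons c a') * g.det := by
      intro a'
      rw [← sum_leviCivita_mul_prod_rows, sum_pi_fin_succ]
      simp only [Fin.prod_univ_succ, Fin.cons_zero, Fin.cons_succ]
    calc (C * gᵀ) a c
        = ∑ b, ∑ a' : Fin d → Fin (d + 1), ∑ b' : Fin d → Fin (d + 1),
          leviCivita (Fin.cons a a') *
            (leviCivita (Fin.cons b b') * (g c b * ∏ s, g (a' s) (b' s))) := by
          simp only [hC, Matrix.mul_apply, Matrix.of_apply, Matrix.transpose_apply, Finset.sum_mul]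
          refine Finset.sum_congr rfl fun _ _ => Finset.sum_congr rfl fun _ _ =>
            Finset.sum_congr rfl fun _ _ => by ring
      _ = ∑ a' : Fin d → Fin (d + 1),
          leviCivita (Fin.cons a a') * (leviCivita (Fin.cons c a') * g.det) := by
          rw [Finset.sum_comm]
          refine Finset.sum_congr rfl fun a' _ => ?_
          simp only [← h1, Finset.mul_sum]
      _ = _ := by
          simp only [← mul_assoc, ← Finset.sum_mul, sum_leviCivita_cons_mul]
          simp only [Matrix.smul_apply, Matrix.one_apply, smul_eq_mul]
          split_ifs <;> simp
  have hgt : IsUnit gᵀ.det := by rwa [Matrix.det_transpose]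
  have h2 : C = ((d.factorial : ℝ) * g.det) • (gᵀ)⁻¹ := by
    rw [← Matrix.mul_nonsing_inv_cancel_right _ C hgt, key, Matrix.smul_mul, Matrix.one_mul]
  have := congrFun (congrFun h2 a) b
  rw [← Matrix.transpose_nonsing_inv] at this
  simpa [hC] using this

/-- Moving the last index to the front is a cycle of length `d + 1`, of sign `(-1) ^ d`. -/
lemma leviCivita_snoc {d : ℕ} (b : Fin d → Fin (d + 1)) (a : Fin (d + 1)) :
    leviCivita (Fin.snoc (α := fun _ => Fin (d + 1)) b a) =
      (-1) ^ d * leviCivita (Fin.cons a b) := by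
  have h : (Fin.snoc (α := fun _ => Fin (d + 1)) b a) =
      (Fin.cons a b : Fin (d + 1) → Fin (d + 1)) ∘ (finRotate (d + 1)) :=
    Fin.snoc_eq_cons_rotate b a
  rw [h]
  by_cases hb : Function.Bijective (Fin.cons a b : Fin (d + 1) → Fin (d + 1))
  · have h1 := leviCivita_perm (Equiv.ofBijective _ hb)
    have h2 := leviCivita_perm ((finRotate (d + 1)).trans (Equiv.ofBijective _ hb))
    rw [Equiv.Perm.sign_trans, sign_finRotate] at h2
    have h3 : leviCivita ((Fin.cons a b : Fin (d + 1) → Fin (d + 1)) ∘ (finRotate (d + 1))) = _ :=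
      h2
    have h4 : leviCivita (Fin.cons a b : Fin (d + 1) → Fin (d + 1)) = _ := h1
    rw [h3, h4]
    push_cast
    simp [mul_comm]
  · rw [leviCivita_of_not_bijective hb, leviCivita_of_not_bijective, mul_zero]
    intro h'
    exact hb ((Function.Bijective.of_comp_iff _ (finRotate (d + 1)).bijective).mp h')

/-- `∑ E^{I₁}_{a₁} ⋯ E^{I_d}_{a_d} G_{IJ} E^{J₁}_{b₁} ⋯ E^{J_d}_{b_d} = ∏ (Eᵀ G E)_{a_s b_s}`. -/
lemma sum_prod_multiIndex {d m n : ℕ} (G : Matrix (Fin m) (Fin m) ℝ) (E : Matrix (Fin m) (Fin n) ℝ)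
    (a b : Fin d → Fin n) :
    ∑ I : Fin d → Fin m, ∑ J : Fin d → Fin m,
      (∏ s, E (I s) (a s)) * (∏ s, E (J s) (b s)) * (∏ s, G (I s) (J s)) =
        ∏ s, (Eᵀ * G * E) (a s) (b s) := by
  have h : ∀ s, (Eᵀ * G * E) (a s) (b s) = ∑ i, ∑ j, E i (a s) * E j (b s) * G i j := by
    intro s
    rw [Matrix.mul_assoc]
    simp only [Matrix.mul_apply, Matrix.transpose_apply, Finset.mul_sum]
    exact Finset.sum_congr rfl fun _ _ => Finset.sum_congr rfl fun _ _ => by ring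
  simp only [h, Finset.prod_univ_sum, Fintype.piFinset_univ, Finset.prod_mul_distrib]

lemma sum_rotate₃ {α β γ : Type*} [Fintype α] [Fintype β] [Fintype γ] (F : α → β → γ → ℝ) :
    ∑ i, ∑ j, ∑ k, F i j k = ∑ k, ∑ i, ∑ j, F i j k :=
  (Finset.sum_congr rfl fun _ _ => Finset.sum_comm).trans Finset.sum_comm

/-- The columns `X` and `Y` in the free slots are kept arbitrary so that one contraction serves both
𝒫² (`X = Y = E`) and ℬ (`Y` the covariant derivative of the normal field). -/
lemma sum_leviCivita_multiIndex {d m : ℕ} (G : Matrix (Fin m) (Fin m) ℝ)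
    (E X Y : Matrix (Fin m) (Fin (d + 1)) ℝ) (hg : IsUnit (Eᵀ * G * E).det) (i k : Fin m) :
    ∑ I : Fin d → Fin m, ∑ J : Fin d → Fin m,
      (∑ a, ∑ a' : Fin d → Fin (d + 1), leviCivita (Fin.cons a a') *
          (X i a * ∏ s, E (I s) (a' s))) *
        (∑ b, ∑ b' : Fin d → Fin (d + 1), leviCivita (Fin.cons b b') *
          (Y k b * ∏ s, E (J s) (b' s))) * (∏ s, G (I s) (J s)) =
      d.factorial * (Eᵀ * G * E).det * ∑ a, ∑ b, X i a * (Eᵀ * G * E)⁻¹ b a * Y k b := by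
  calc _ = ∑ I : Fin d → Fin m, ∑ J : Fin d → Fin m,
        ∑ a, ∑ b, ∑ a' : Fin d → Fin (d + 1), ∑ b' : Fin d → Fin (d + 1),
          (X i a * Y k b) * ((leviCivita (Fin.cons a a') * leviCivita (Fin.cons b b')) *
            ((∏ s, E (I s) (a' s)) * (∏ s, E (J s) (b' s)) * (∏ s, G (I s) (J s)))) := by
        refine Finset.sum_congr rfl fun I _ => Finset.sum_congr rfl fun J _ => ?_
        rw [Finset.sum_mul_sum, Finset.sum_mul]
        refine Finset.sum_congr rfl fun a _ => ?_
        rw [Finset.sum_mul]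
        refine Finset.sum_congr rfl fun b _ => ?_
        rw [Finset.sum_mul_sum, Finset.sum_mul]
        refine Finset.sum_congr rfl fun a' _ => ?_
        rw [Finset.sum_mul]
        exact Finset.sum_congr rfl fun b' _ => by ring
    -- With the ambient multi-indices summed innermost, `sum_prod_multiIndex` replaces them by a
    -- product of entries of `Eᵀ * G * E`.
    _ = ∑ a, ∑ b, ∑ a' : Fin d → Fin (d + 1), ∑ b' : Fin d → Fin (d + 1),
          ∑ I : Fin d → Fin m, ∑ J : Fin d → Fin m,
          (X i a * Y k b) * ((leviCivita (Fin.cons a a') * leviCivita (Fin.cons b b')) *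
            ((∏ s, E (I s) (a' s)) * (∏ s, E (J s) (b' s)) * (∏ s, G (I s) (J s)))) := by
        rw [sum_rotate₃]
        refine Finset.sum_congr rfl fun a _ => ?_
        rw [sum_rotate₃]
        refine Finset.sum_congr rfl fun b _ => ?_
        rw [sum_rotate₃]
        refine Finset.sum_congr rfl fun a' _ => ?_
        rw [sum_rotate₃]
    _ = _ := by
        simp only [← Finset.mul_sum, sum_prod_multiIndex, sum_leviCivita_leviCivita_prod _ hg]
        simp only [Finset.mul_sum]
        exact Finset.sum_congr rfl fun a _ => Finset.sum_congr rfl fun b _ => by ring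

/-! ### The tensors `𝒫²` and `ℬ` -/

section Tensors

variable {d m : ℕ} (G : EuclideanSpace ℝ (Fin m) → Matrix (Fin m) (Fin m) ℝ)
  (ρ : EuclideanSpace ℝ (Fin (d + 1)) → ℝ)
  (x ν : Fin m → EuclideanSpace ℝ (Fin (d + 1)) → ℝ)

lemma tensorP_eq (i : Fin m) (J : Fin d → Fin m) (u : EuclideanSpace ℝ (Fin (d + 1))) :
    tensorP ρ x i J u = (1 / √(d.factorial : ℝ)) * (1 / ρ u) *
      ∑ a, ∑ a' : Fin d → Fin (d + 1), leviCivita (Fin.cons a a') *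
          (pd (x i) a u * ∏ s, pd (x (J s)) (a' s) u) := by
  rw [tensorP, nambu, sum_pi_fin_succ]
  simp only [Fin.prod_univ_succ, Fin.cons_zero, Fin.cons_succ, mul_assoc]

/-- The prefactor `(-1) ^ (d + 1)` and the sign `(-1) ^ d` of `leviCivita_snoc` combine to `-1`,
leaving the same shape as in `tensorP_eq`. -/
lemma tensorT_eq (J : Fin d → Fin m) (k : Fin m) (u : EuclideanSpace ℝ (Fin (d + 1))) :
    tensorT G ρ x ν J k u = -((1 / √(d.factorial : ℝ)) * (1 / ρ u)) *
      ∑ a, ∑ a' : Fin d → Fin (d + 1), leviCivita (Fin.cons a a') *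
          (covDerivAlong G x ν a k u * ∏ s, pd (x (J s)) (a' s) u) := by
  rw [tensorT, Finset.sum_comm]
  simp only [Finset.mul_sum, leviCivita_snoc]
  refine Finset.sum_congr rfl fun a _ => Finset.sum_congr rfl fun b _ => ?_
  have h : ((-1 : ℝ) ^ d) * (-1) ^ d = 1 := by rw [← mul_pow]; simp
  rw [pow_succ]
  linear_combination (-(1 / √(d.factorial : ℝ)) * (1 / ρ u) *
    (leviCivita (Fin.cons a b) * (covDerivAlong G x ν a k u * ∏ s, pd (x (J s)) (b s) u))) * h

/-- The Jacobian `E^i_a = ∂ₐ x^i`. -/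
def jac (u : EuclideanSpace ℝ (Fin (d + 1))) : Matrix (Fin m) (Fin (d + 1)) ℝ :=
  Matrix.of fun i a => pd (x i) a u

/-- The ambient metric along the embedding. -/
def metricAlong (u : EuclideanSpace ℝ (Fin (d + 1))) : Matrix (Fin m) (Fin m) ℝ :=
  G (WithLp.toLp 2 fun i => x i u)

/-- The matrix of components `(∇̄ₐ ν)^k`. -/
def covDerivMatrix (u : EuclideanSpace ℝ (Fin (d + 1))) : Matrix (Fin m) (Fin (d + 1)) ℝ :=
  Matrix.of fun k a => covDerivAlong G x ν a k u

/-- The induced metric `g = Eᵀ Ḡ E`. -/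
def pullbackMetric (u : EuclideanSpace ℝ (Fin (d + 1))) :
    Matrix (Fin (d + 1)) (Fin (d + 1)) ℝ :=
  (jac x u)ᵀ * metricAlong G x u * jac x u

variable {G ρ x ν} {u : EuclideanSpace ℝ (Fin (d + 1))}

/-- The normalisations of the two tensors cancel the `d!` produced by the contraction. -/
lemma one_div_sqrt_factorial_sq (d : ℕ) :
    (1 / √(d.factorial : ℝ)) * (1 / √(d.factorial : ℝ)) * d.factorial = 1 := by
  have h : (0 : ℝ) < d.factorial := by exact_mod_cast d.factorial_pos
  rw [div_mul_div_comm, Real.mul_self_sqrt h.le]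
  field_simp

/-- The case `X = Y = E` of `sum_leviCivita_multiIndex`. Symmetry of the metric is not assumed yet,
so the inverse appears transposed. -/
lemma tensorP2_eq (hg : IsUnit (pullbackMetric G x u).det) (i k : Fin m) :
    tensorP2 G ρ x u i k = ((pullbackMetric G x u).det / ρ u ^ 2) *
      (jac x u * ((pullbackMetric G x u)⁻¹)ᵀ * (jac x u)ᵀ) i k := by
  have h := sum_leviCivita_multiIndex (metricAlong G x u) (jac x u) (jac x u) (jac x u) hg i k
  have h2 : (jac x u * ((pullbackMetric G x u)⁻¹)ᵀ * (jac x u)ᵀ) i k =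
      ∑ a, ∑ b, jac x u i a * (pullbackMetric G x u)⁻¹ b a * jac x u k b := by
    simp only [Matrix.mul_apply, Matrix.transpose_apply, Finset.sum_mul]
    exact Finset.sum_comm
  rw [h2, tensorP2]
  change _ = _ * (pullbackMetric G x u).det * ∑ a, ∑ b,
    jac x u i a * (pullbackMetric G x u)⁻¹ b a * jac x u k b at h
  set S := ∑ a, ∑ b, jac x u i a * (pullbackMetric G x u)⁻¹ b a * jac x u k b
  have h3 := one_div_sqrt_factorial_sq d
  have h4 : (∑ I : Fin d → Fin m, ∑ J : Fin d → Fin m,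
      tensorP ρ x i I u * tensorP ρ x k J u * multiMetric G x I J u) =
      ((1 / √(d.factorial : ℝ)) * (1 / √(d.factorial : ℝ)) * (1 / ρ u) ^ 2) *
        (d.factorial * (pullbackMetric G x u).det * S) := by
    rw [← h]
    simp only [Finset.mul_sum _ _ ((1 / √(d.factorial : ℝ)) * (1 / √(d.factorial : ℝ)) *
      (1 / ρ u) ^ 2)]
    refine Finset.sum_congr rfl fun I _ => Finset.sum_congr rfl fun J _ => ?_
    rw [tensorP_eq, tensorP_eq]
    simp only [jac, metricAlong, multiMetric, Matrix.of_apply]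
    ring
  rw [h4]
  linear_combination ((1 / ρ u) ^ 2 * (pullbackMetric G x u).det * S) * h3

lemma tensorB_eq (hg : IsUnit (pullbackMetric G x u).det) (i k : Fin m) :
    tensorB G ρ x ν u i k = -((pullbackMetric G x u).det / ρ u ^ 2) *
      (jac x u * ((pullbackMetric G x u)⁻¹)ᵀ * (covDerivMatrix G x ν u)ᵀ) i k := by
  have h := sum_leviCivita_multiIndex (metricAlong G x u) (jac x u) (jac x u)
    (covDerivMatrix G x ν u) hg i k
  have h2 : (jac x u * ((pullbackMetric G x u)⁻¹)ᵀ * (covDerivMatrix G x ν u)ᵀ) i k =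
      ∑ a, ∑ b, jac x u i a * (pullbackMetric G x u)⁻¹ b a * covDerivMatrix G x ν u k b := by
    simp only [Matrix.mul_apply, Matrix.transpose_apply, Finset.sum_mul]
    exact Finset.sum_comm
  rw [h2, tensorB]
  change _ = _ * (pullbackMetric G x u).det * ∑ a, ∑ b,
    jac x u i a * (pullbackMetric G x u)⁻¹ b a * covDerivMatrix G x ν u k b at h
  set S := ∑ a, ∑ b, jac x u i a * (pullbackMetric G x u)⁻¹ b a * covDerivMatrix G x ν u k b
  have h3 := one_div_sqrt_factorial_sq d
  have h4 : (∑ I : Fin d → Fin m, ∑ J : Fin d → Fin m,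
      tensorP ρ x i I u * tensorT G ρ x ν J k u * multiMetric G x I J u) =
      (-((1 / √(d.factorial : ℝ)) * (1 / √(d.factorial : ℝ)) * (1 / ρ u) ^ 2)) *
        (d.factorial * (pullbackMetric G x u).det * S) := by
    rw [← h]
    simp only [Finset.mul_sum _ _ (-((1 / √(d.factorial : ℝ)) * (1 / √(d.factorial : ℝ)) *
      (1 / ρ u) ^ 2))]
    refine Finset.sum_congr rfl fun I _ => Finset.sum_congr rfl fun J _ => ?_
    rw [tensorP_eq, tensorT_eq]
    simp only [jac, metricAlong, multiMetric, covDerivMatrix, Matrix.of_apply]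
    ring
  rw [h4]
  linear_combination (-(1 / ρ u) ^ 2 * (pullbackMetric G x u).det * S) * h3

/-- The matrix of `ℬ` is `-γ² E g⁻¹ (∇̄ν)ᵀ Ḡ`. -/
lemma mixedB_eq (hg : IsUnit (pullbackMetric G x u).det) :
    mixedB G ρ x ν u = (-((pullbackMetric G x u).det / ρ u ^ 2)) •
      (jac x u * ((pullbackMetric G x u)⁻¹)ᵀ * (covDerivMatrix G x ν u)ᵀ * metricAlong G x u) := by
  ext i j
  simp only [mixedB, Matrix.of_apply, tensorB_eq hg]
  rw [Matrix.smul_apply, Matrix.mul_apply, smul_eq_mul, Finset.mul_sum]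
  exact Finset.sum_congr rfl fun k _ => by rw [mul_assoc]; rfl

end Tensors

/-! ### Partial derivatives -/

section PartialDerivatives

variable {n m : ℕ} {f h : EuclideanSpace ℝ (Fin n) → ℝ} {a b : Fin n}
  {u : EuclideanSpace ℝ (Fin n)}

lemma pd_congr (hfh : f =ᶠ[𝓝 u] h) : pd f a u = pd h a u := by
  rw [pd, pd, hfh.fderiv_eq]

lemma pd_add (hf : DifferentiableAt ℝ f u) (hh : DifferentiableAt ℝ h u) :
    pd (fun v => f v + h v) a u = pd f a u + pd h a u := by
  simp only [pd, fderiv_fun_add hf hh, _root_.add_apply]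

lemma pd_mul (hf : DifferentiableAt ℝ f u) (hh : DifferentiableAt ℝ h u) :
    pd (fun v => f v * h v) a u = pd f a u * h u + f u * pd h a u := by
  simp only [pd, fderiv_fun_mul hf hh, _root_.add_apply, _root_.smul_apply,
    smul_eq_mul]
  ring

lemma pd_sum {ι : Type*} {s : Finset ι} {F : ι → EuclideanSpace ℝ (Fin n) → ℝ}
    (hF : ∀ i ∈ s, DifferentiableAt ℝ (F i) u) :
    pd (fun v => ∑ i ∈ s, F i v) a u = ∑ i ∈ s, pd (F i) a u := by
  simp only [pd, fderiv_fun_sum hF, _root_.sum_apply]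

lemma contDiffAt_pd (hf : ContDiffAt ℝ ∞ f u) : ContDiffAt ℝ ∞ (pd f a) u :=
  (hf.fderiv_right (m := ∞) (by norm_num)).clm_apply contDiffAt_const

lemma pd_comm (hf : ContDiffAt ℝ ∞ f u) : pd (pd f b) a u = pd (pd f a) b u := by
  have hd : DifferentiableAt ℝ (fderiv ℝ f) u :=
    (hf.fderiv_right (m := ∞) (by norm_num)).differentiableAt (by norm_num)
  have h1 : ∀ a b : Fin n, pd (pd f b) a u =
      fderiv ℝ (fderiv ℝ f) u (EuclideanSpace.single a 1) (EuclideanSpace.single b 1) := by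
    intro a b
    change fderiv ℝ (fun v => fderiv ℝ f v (EuclideanSpace.single b 1)) u _ = _
    rw [fderiv_clm_apply hd (differentiableAt_const _)]
    simp
  rw [h1, h1]
  exact (hf.isSymmSndFDerivAt (by
    rw [minSmoothness_of_isRCLikeNormedField]
    exact WithTop.coe_le_coe.mpr (le_top : (2 : ℕ∞) ≤ ⊤))).eq _ _

lemma contDiffAt_toLp {x : Fin m → EuclideanSpace ℝ (Fin n) → ℝ}
    (hx : ∀ i, ContDiffAt ℝ ∞ (x i) u) :
    ContDiffAt ℝ ∞ (fun v => (WithLp.toLp 2 fun i => x i v : EuclideanSpace ℝ (Fin m))) u :=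
  contDiffAt_piLp 2 |>.mpr hx

lemma fderiv_eq_sum_pd (F : EuclideanSpace ℝ (Fin m) → ℝ) (y w : EuclideanSpace ℝ (Fin m)) :
    fderiv ℝ F y w = ∑ k, pd F k y * w k := by
  conv_lhs => rw [← (EuclideanSpace.basisFun (Fin m) ℝ).sum_repr w]
  simp only [map_sum, map_smul, pd, EuclideanSpace.basisFun_apply, EuclideanSpace.basisFun_repr,
    smul_eq_mul]
  exact Finset.sum_congr rfl fun _ _ => mul_comm _ _

lemma pd_comp {F : EuclideanSpace ℝ (Fin m) → ℝ} {x : Fin m → EuclideanSpace ℝ (Fin n) → ℝ}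
    (hF : DifferentiableAt ℝ F (WithLp.toLp 2 fun i => x i u))
    (hx : ∀ i, DifferentiableAt ℝ (x i) u) :
    pd (fun v => F (WithLp.toLp 2 fun i => x i v)) a u =
      ∑ k, pd F k (WithLp.toLp 2 fun i => x i u) * pd (x k) a u := by
  have hX : HasFDerivAt (fun v => (WithLp.toLp 2 fun i => x i v : EuclideanSpace ℝ (Fin m)))
      (fderiv ℝ (fun v => (WithLp.toLp 2 fun i => x i v : EuclideanSpace ℝ (Fin m))) u) u :=
    (differentiableAt_piLp 2 |>.mpr hx).hasFDerivAt
  have hc := (hF.hasFDerivAt.comp u hX).fderiv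
  change fderiv ℝ (F ∘ fun v => (WithLp.toLp 2 fun i => x i v : EuclideanSpace ℝ (Fin m))) u _ = _
  rw [hc, ContinuousLinearMap.comp_apply, fderiv_eq_sum_pd]
  refine Finset.sum_congr rfl fun k _ => ?_
  congr 1
  have hk : fderiv ℝ (x k) u = _ :=
    ((EuclideanSpace.proj k : EuclideanSpace ℝ (Fin m) →L[ℝ] ℝ).hasFDerivAt.comp u hX).fderiv
  rw [pd, hk]
  rfl

end PartialDerivatives

/-! ### Metrics in coordinates -/

section Metrics

variable {n : ℕ}

/-- `G` is smooth at `y`, nondegenerate at `y` and symmetric near `y`. -/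
structure SmoothMetricAt (G : EuclideanSpace ℝ (Fin n) → Matrix (Fin n) (Fin n) ℝ)
    (y : EuclideanSpace ℝ (Fin n)) : Prop where
  contDiffAt : ∀ i j, ContDiffAt ℝ ∞ (fun v => G v i j) y
  symm : ∀ᶠ v in 𝓝 y, ∀ i j, G v i j = G v j i
  isUnit_det : IsUnit (G y).det

/-- The Christoffel symbol of the first kind. -/
def christoffelLow (G : EuclideanSpace ℝ (Fin n) → Matrix (Fin n) (Fin n) ℝ)
    (l j k : Fin n) (u : EuclideanSpace ℝ (Fin n)) : ℝ :=
  (1 / 2) *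
    (pd (fun v => G v l k) j u + pd (fun v => G v l j) k u - pd (fun v => G v j k) l u)

variable {G : EuclideanSpace ℝ (Fin n) → Matrix (Fin n) (Fin n) ℝ} {y : EuclideanSpace ℝ (Fin n)}

lemma christoffel_eq (i j k : Fin n) :
    christoffel G i j k y = ∑ l, (G y)⁻¹ i l * christoffelLow G l j k y := by
  rw [christoffel, Finset.mul_sum]
  exact Finset.sum_congr rfl fun l _ => by rw [christoffelLow]; ring

lemma contDiffAt_det {A : EuclideanSpace ℝ (Fin n) → Matrix (Fin n) (Fin n) ℝ}
    (hA : ∀ i j, ContDiffAt ℝ ∞ (fun v => A v i j) y) :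
    ContDiffAt ℝ ∞ (fun v => (A v).det) y := by
  simp only [Matrix.det_apply']
  exact ContDiffAt.sum fun σ _ => contDiffAt_const.mul (contDiffAt_prod fun i _ => hA _ _)

/-- Cramer's rule: each entry is a determinant with one row replaced by a constant, divided by a
determinant that does not vanish at `y`. -/
lemma contDiffAt_inv {A : EuclideanSpace ℝ (Fin n) → Matrix (Fin n) (Fin n) ℝ}
    (hA : ∀ i j, ContDiffAt ℝ ∞ (fun v => A v i j) y) (hdet : IsUnit (A y).det) (i j : Fin n) :
    ContDiffAt ℝ ∞ (fun v => (A v)⁻¹ i j) y := by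
  simp only [Matrix.inv_def, Matrix.smul_apply, smul_eq_mul, Ring.inverse_eq_inv',
    Matrix.adjugate_apply]
  refine ((contDiffAt_det hA).inv hdet.ne_zero).mul (contDiffAt_det fun k l => ?_)
  by_cases hk : k = j
  · subst hk
    simp only [Matrix.updateRow_self]
    exact contDiffAt_const
  · simp only [Matrix.updateRow_ne hk]
    exact hA k l

namespace SmoothMetricAt

lemma contDiffAt_christoffel (hG : SmoothMetricAt G y) (i j k : Fin n) :
    ContDiffAt ℝ ∞ (christoffel G i j k) y := by
  refine contDiffAt_const.mul (ContDiffAt.sum fun l _ => ?_)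
  exact (contDiffAt_inv hG.contDiffAt hG.isUnit_det i l).mul
    (((contDiffAt_pd (hG.contDiffAt _ _)).add (contDiffAt_pd (hG.contDiffAt _ _))).sub
      (contDiffAt_pd (hG.contDiffAt _ _)))

lemma pd_symm (hG : SmoothMetricAt G y) (i j k : Fin n) :
    pd (fun v => G v i j) k y = pd (fun v => G v j i) k y :=
  pd_congr (hG.symm.mono fun _ hv => hv i j)

lemma apply_symm (hG : SmoothMetricAt G y) (i j : Fin n) : G y i j = G y j i :=
  hG.symm.self_of_nhds i j

lemma christoffel_symm (hG : SmoothMetricAt G y) (i j k : Fin n) :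
    christoffel G i j k y = christoffel G i k j y := by
  simp only [christoffel_eq, christoffelLow]
  refine Finset.sum_congr rfl fun l _ => ?_
  rw [hG.pd_symm j k l]
  ring

lemma sum_mul_christoffel (hG : SmoothMetricAt G y) (i j k : Fin n) :
    ∑ l, G y i l * christoffel G l j k y = christoffelLow G i j k y := by
  have h := congrFun (Matrix.mulVec_mulVec (fun l => christoffelLow G l j k y) (G y) (G y)⁻¹) i
  rw [Matrix.mul_nonsing_inv _ hG.isUnit_det, Matrix.one_mulVec] at h
  rw [← h]
  simp only [christoffel_eq]
  rfl

/-- This is ∇G = 0 with lowered indices; the other derivatives of the metric cancel by symmetry. -/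
lemma pd_eq_christoffelLow_add (hG : SmoothMetricAt G y) (i j k : Fin n) :
    pd (fun v => G v i j) k y = christoffelLow G i k j y + christoffelLow G j k i y := by
  simp only [christoffelLow]
  rw [hG.pd_symm j i k, hG.pd_symm i k j, hG.pd_symm j k i]
  ring

end SmoothMetricAt

end Metrics

/-! ### Covariant derivatives along a map -/

section Along

variable {d m : ℕ} {G : EuclideanSpace ℝ (Fin m) → Matrix (Fin m) (Fin m) ℝ}
  {x ν τ : Fin m → EuclideanSpace ℝ (Fin (d + 1)) → ℝ} {u : EuclideanSpace ℝ (Fin (d + 1))}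
  {a b c e : Fin (d + 1)}

/-- The inner product of two vector fields along a map, in coordinates. -/
def innerAlong (G : EuclideanSpace ℝ (Fin m) → Matrix (Fin m) (Fin m) ℝ)
    (x ν τ : Fin m → EuclideanSpace ℝ (Fin (d + 1)) → ℝ) (u : EuclideanSpace ℝ (Fin (d + 1))) : ℝ :=
  ∑ i, ∑ j, metricAlong G x u i j * (ν i u * τ j u)

lemma contDiffAt_metricAlong (hG : SmoothMetricAt G (WithLp.toLp 2 fun i => x i u))
    (hx : ∀ i, ContDiffAt ℝ ∞ (x i) u) (i j : Fin m) :
    ContDiffAt ℝ ∞ (fun v => metricAlong G x v i j) u :=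
  ContDiffAt.comp (g := fun z => G z i j) (f := fun v => WithLp.toLp 2 fun i => x i v) u
    (hG.contDiffAt i j) (contDiffAt_toLp hx)

lemma contDiffAt_christoffelAlong (hG : SmoothMetricAt G (WithLp.toLp 2 fun i => x i u))
    (hx : ∀ i, ContDiffAt ℝ ∞ (x i) u) (i j k : Fin m) :
    ContDiffAt ℝ ∞ (fun v => christoffel G i j k (WithLp.toLp 2 fun i => x i v)) u :=
  ContDiffAt.comp (g := christoffel G i j k) (f := fun v => WithLp.toLp 2 fun i => x i v) u
    (hG.contDiffAt_christoffel i j k) (contDiffAt_toLp hx)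

lemma contDiffAt_covDerivAlong (hG : SmoothMetricAt G (WithLp.toLp 2 fun i => x i u))
    (hx : ∀ i, ContDiffAt ℝ ∞ (x i) u) (hν : ∀ i, ContDiffAt ℝ ∞ (ν i) u) (j : Fin m) :
    ContDiffAt ℝ ∞ (covDerivAlong G x ν a j) u :=
  (contDiffAt_pd (hν j)).add (ContDiffAt.sum fun k _ => ContDiffAt.sum fun l _ =>
    ((contDiffAt_christoffelAlong hG hx j k l).mul (contDiffAt_pd (hx k))).mul (hν l))

lemma contDiffAt_innerAlong (hG : SmoothMetricAt G (WithLp.toLp 2 fun i => x i u))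
    (hx : ∀ i, ContDiffAt ℝ ∞ (x i) u) (hν : ∀ i, ContDiffAt ℝ ∞ (ν i) u)
    (hτ : ∀ i, ContDiffAt ℝ ∞ (τ i) u) : ContDiffAt ℝ ∞ (innerAlong G x ν τ) u :=
  ContDiffAt.sum fun i _ => ContDiffAt.sum fun j _ =>
    (contDiffAt_metricAlong hG hx i j).mul ((hν i).mul (hτ j))

lemma innerAlong_comm (hG : SmoothMetricAt G (WithLp.toLp 2 fun i => x i u)) :
    innerAlong G x ν τ u = innerAlong G x τ ν u := by
  rw [innerAlong, innerAlong, Finset.sum_comm]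
  refine Finset.sum_congr rfl fun i _ => Finset.sum_congr rfl fun j _ => ?_
  rw [metricAlong, hG.apply_symm j i, mul_comm (ν j u)]

/-- Metric compatibility. -/
lemma pd_innerAlong (hG : SmoothMetricAt G (WithLp.toLp 2 fun i => x i u))
    (hx : ∀ i, ContDiffAt ℝ ∞ (x i) u) (hν : ∀ i, ContDiffAt ℝ ∞ (ν i) u)
    (hτ : ∀ i, ContDiffAt ℝ ∞ (τ i) u) :
    pd (innerAlong G x ν τ) a u =
      innerAlong G x (covDerivAlong G x ν a) τ u + innerAlong G x ν (covDerivAlong G x τ a) u := by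
  have hne : (∞ : WithTop ℕ∞) ≠ 0 := by norm_num
  have dG : ∀ i j, DifferentiableAt ℝ (fun v => metricAlong G x v i j) u := fun i j =>
    (contDiffAt_metricAlong hG hx i j).differentiableAt hne
  have dν : ∀ i, DifferentiableAt ℝ (ν i) u := fun i => (hν i).differentiableAt hne
  have dτ : ∀ i, DifferentiableAt ℝ (τ i) u := fun i => (hτ i).differentiableAt hne
  have dx : ∀ i, DifferentiableAt ℝ (x i) u := fun i => (hx i).differentiableAt hne
  set y : EuclideanSpace ℝ (Fin m) := WithLp.toLp 2 fun i => x i u with hy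
  have h1 : pd (innerAlong G x ν τ) a u = ∑ i, ∑ j,
      ((∑ k, (christoffelLow G i k j y + christoffelLow G j k i y) * pd (x k) a u) *
          (ν i u * τ j u) + G y i j * (pd (ν i) a u * τ j u + ν i u * pd (τ j) a u)) := by
    change pd (fun v => ∑ i, ∑ j, metricAlong G x v i j * (ν i v * τ j v)) a u = _
    rw [pd_sum fun i _ => DifferentiableAt.fun_sum fun j _ =>
      (dG i j).fun_mul ((dν i).fun_mul (dτ j))]
    refine Finset.sum_congr rfl fun i _ => ?_
    rw [pd_sum fun j _ => (dG i j).fun_mul ((dν i).fun_mul (dτ j))]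
    refine Finset.sum_congr rfl fun j _ => ?_
    rw [pd_mul (dG i j) ((dν i).fun_mul (dτ j)), pd_mul (dν i) (dτ j)]
    congr 2
    unfold metricAlong
    rw [pd_comp ((hG.contDiffAt i j).differentiableAt hne) dx]
    exact Finset.sum_congr rfl fun k _ => by rw [hG.pd_eq_christoffelLow_add]
  -- Stated for all pairs of fields: the term with the derivative in the first slot is the same
  -- formula with `ν` and `τ` exchanged.
  have h2 : ∀ ν τ : Fin m → EuclideanSpace ℝ (Fin (d + 1)) → ℝ,
      innerAlong G x ν (covDerivAlong G x τ a) u = ∑ i, ∑ j,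
      ((∑ k, christoffelLow G i k j y * pd (x k) a u) * (ν i u * τ j u) +
        G y i j * (ν i u * pd (τ j) a u)) := by
    intro ν τ
    refine Finset.sum_congr rfl fun i _ => ?_
    simp only [covDerivAlong, mul_add, Finset.sum_add_distrib]
    rw [add_comm]
    congr 1
    simp only [← hG.sum_mul_christoffel, Finset.mul_sum, Finset.sum_mul]
    rw [sum_rotate₃]
    refine Finset.sum_congr rfl fun l _ => ?_
    rw [Finset.sum_comm]
    exact Finset.sum_congr rfl fun j _ => Finset.sum_congr rfl fun k _ => by
      rw [metricAlong]; ring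
  have h3 : innerAlong G x τ (covDerivAlong G x ν a) u = _ := (h2 τ ν).trans Finset.sum_comm
  rw [innerAlong_comm hG (ν := covDerivAlong G x ν a), h3, h2, h1, ← Finset.sum_add_distrib]
  refine Finset.sum_congr rfl fun i _ => ?_
  rw [← Finset.sum_add_distrib]
  refine Finset.sum_congr rfl fun j _ => ?_
  rw [hG.apply_symm j i]
  simp only [add_mul, Finset.sum_add_distrib]
  ring

/-- The covariant derivative is torsion free. -/
lemma covDerivAlong_pd_comm (hG : SmoothMetricAt G (WithLp.toLp 2 fun i => x i u))
    (hx : ∀ i, ContDiffAt ℝ ∞ (x i) u) (j : Fin m) :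
    covDerivAlong G x (fun i => pd (x i) b) a j u =
      covDerivAlong G x (fun i => pd (x i) a) b j u := by
  rw [covDerivAlong, covDerivAlong, pd_comm (hx j), Finset.sum_comm]
  congr 1
  refine Finset.sum_congr rfl fun k _ => Finset.sum_congr rfl fun l _ => ?_
  rw [hG.christoffel_symm j l k]
  ring

/-- The commutator of covariant derivatives along a map is the ambient curvature. -/
lemma covDerivAlong_commutator (hG : SmoothMetricAt G (WithLp.toLp 2 fun i => x i u))
    (hx : ∀ i, ContDiffAt ℝ ∞ (x i) u) (hν : ∀ i, ContDiffAt ℝ ∞ (ν i) u) (i : Fin m) :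
    covDerivAlong G x (covDerivAlong G x ν e) c i u
        - covDerivAlong G x (covDerivAlong G x ν c) e i u =
      ∑ j, ∑ k, ∑ l, riemannUp G i j k l (WithLp.toLp 2 fun i => x i u) *
        (ν j u * pd (x k) c u * pd (x l) e u) := by
  have hne : (∞ : WithTop ℕ∞) ≠ 0 := by norm_num
  set y : EuclideanSpace ℝ (Fin m) := WithLp.toLp 2 fun i => x i u with hy
  have dx : ∀ i, DifferentiableAt ℝ (x i) u := fun i => (hx i).differentiableAt hne
  have dν : ∀ i, DifferentiableAt ℝ (ν i) u := fun i => (hν i).differentiableAt hne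
  have dpx : ∀ a i, DifferentiableAt ℝ (pd (x i) a) u := fun a i =>
    (contDiffAt_pd (hx i)).differentiableAt hne
  have dpν : ∀ a i, DifferentiableAt ℝ (pd (ν i) a) u := fun a i =>
    (contDiffAt_pd (hν i)).differentiableAt hne
  have dΓ : ∀ k l, DifferentiableAt ℝ
      (fun v => christoffel G i k l (WithLp.toLp 2 fun i => x i v)) u := fun k l =>
    (contDiffAt_christoffelAlong hG hx i k l).differentiableAt hne
  -- The second covariant derivative splits into ∂∂ν, derivatives of Γ (`A`), products ΓΓ (`B`),
  -- second derivatives of `x` (`S`) and mixed terms (`T`). In the commutator ∂∂ν, `S` and `T e c +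
  -- T c e` cancel by symmetry, and `A`, `B` make up the curvature. The names are opaque so that
  -- `ring` treats them as atoms.
  obtain ⟨A, hA⟩ : ∃ A : Fin (d + 1) → Fin (d + 1) → ℝ, A = fun c e =>
    ∑ j, ∑ k, ∑ l, pd (christoffel G i l j) k y * (ν j u * pd (x k) c u * pd (x l) e u) := ⟨_, rfl⟩
  obtain ⟨B, hB⟩ : ∃ B : Fin (d + 1) → Fin (d + 1) → ℝ, B = fun c e =>
    ∑ j, ∑ k, ∑ l, (∑ s, christoffel G i k s y * christoffel G s l j y) *
      (ν j u * pd (x k) c u * pd (x l) e u) := ⟨_, rfl⟩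
  obtain ⟨S, hS⟩ : ∃ S : Fin (d + 1) → Fin (d + 1) → ℝ, S = fun c e =>
    ∑ k, ∑ l, christoffel G i k l y * pd (pd (x k) e) c u * ν l u := ⟨_, rfl⟩
  obtain ⟨T, hT⟩ : ∃ T : Fin (d + 1) → Fin (d + 1) → ℝ, T = fun c e =>
    ∑ k, ∑ l, christoffel G i k l y * pd (x k) c u * pd (ν l) e u := ⟨_, rfl⟩
  have hexp : ∀ c e, covDerivAlong G x (covDerivAlong G x ν e) c i u =
      pd (pd (ν i) e) c u + A c e + S c e + T e c + T c e + B c e := by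
    intro c e
    have h1 : pd (covDerivAlong G x ν e i) c u = pd (pd (ν i) e) c u + A c e + S c e + T e c := by
      change pd (fun v => pd (ν i) e v + ∑ k, ∑ l,
        christoffel G i k l (WithLp.toLp 2 fun i => x i v) * pd (x k) e v * ν l v) c u = _
      have dt : ∀ k l, DifferentiableAt ℝ (fun v =>
          christoffel G i k l (WithLp.toLp 2 fun i => x i v) * pd (x k) e v * ν l v) u :=
        fun k l => ((dΓ k l).fun_mul (dpx e k)).fun_mul (dν l)
      rw [pd_add (dpν e i) (DifferentiableAt.fun_sum fun k _ => DifferentiableAt.fun_sum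
        fun l _ => dt k l), pd_sum fun k _ => DifferentiableAt.fun_sum fun l _ => dt k l]
      have h2 : ∀ k l, pd (fun v =>
          christoffel G i k l (WithLp.toLp 2 fun i => x i v) * pd (x k) e v * ν l v) c u =
          (∑ r, pd (christoffel G i k l) r y * (ν l u * pd (x r) c u * pd (x k) e u)) +
            christoffel G i k l y * pd (pd (x k) e) c u * ν l u +
            christoffel G i k l y * pd (x k) e u * pd (ν l) c u := by
        intro k l
        rw [pd_mul ((dΓ k l).fun_mul (dpx e k)) (dν l), pd_mul (dΓ k l) (dpx e k),
          pd_comp ((hG.contDiffAt_christoffel i k l).differentiableAt hne) dx, add_mul,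
          Finset.sum_mul, Finset.sum_mul]
        congr 2
        exact Finset.sum_congr rfl fun r _ => by ring
      have h3 : ∀ k, pd (fun v => ∑ l,
          christoffel G i k l (WithLp.toLp 2 fun i => x i v) * pd (x k) e v * ν l v) c u = _ :=
        fun k => (pd_sum fun l _ => dt k l).trans (Finset.sum_congr rfl fun l _ => h2 k l)
      simp only [h3, Finset.sum_add_distrib]
      rw [hA, hS, hT, ← add_assoc, ← add_assoc]
      congr 3
      rw [Finset.sum_comm]
      exact Finset.sum_congr rfl fun l _ => Finset.sum_comm
    rw [covDerivAlong, h1, add_assoc _ (T c e)]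
    congr 1
    have h4 : ∀ l, covDerivAlong G x ν e l u = pd (ν l) e u +
      ∑ s, ∑ t, christoffel G l s t y * pd (x s) e u * ν t u := fun l => rfl
    simp only [h4, mul_add, Finset.sum_add_distrib]
    rw [hT, hB]
    congr 1
    simp only [Finset.mul_sum, Finset.sum_mul]
    calc _ = ∑ k, ∑ j, ∑ l, ∑ s, christoffel G i k l y * pd (x k) c u *
          (christoffel G l s j y * pd (x s) e u * ν j u) :=
          Finset.sum_congr rfl fun k _ => sum_rotate₃ _
      _ = _ := by
          rw [Finset.sum_comm]
          refine Finset.sum_congr rfl fun j _ => Finset.sum_congr rfl fun k _ => ?_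
          rw [Finset.sum_comm]
          exact Finset.sum_congr rfl fun l _ => Finset.sum_congr rfl fun s _ => by
            ring
  have hSs : S c e = S e c := by
    simp only [hS]
    exact Finset.sum_congr rfl fun k _ => Finset.sum_congr rfl fun l _ => by rw [pd_comm (hx k)]
  have hR : ∑ j, ∑ k, ∑ l, riemannUp G i j k l y * (ν j u * pd (x k) c u * pd (x l) e u) =
      A c e - A e c + B c e - B e c := by
    have swap : ∀ F : Fin m → Fin m → Fin m → ℝ,
        ∑ j, ∑ k, ∑ l, F j k l = ∑ j, ∑ k, ∑ l, F j l k := fun F =>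
      Finset.sum_congr rfl fun _ _ => Finset.sum_comm
    have hA' : A e c = _ := (congrFun (congrFun hA e) c).trans (swap _)
    have hB' : B e c = _ := (congrFun (congrFun hB e) c).trans (swap _)
    rw [hA', hB', hA, hB]
    simp only [← Finset.sum_sub_distrib, ← Finset.sum_add_distrib]
    refine Finset.sum_congr rfl fun j _ => Finset.sum_congr rfl fun k _ =>
      Finset.sum_congr rfl fun l _ => ?_
    rw [riemannUp, Finset.sum_sub_distrib]
    ring
  rw [hexp, hexp, hR, hSs, pd_comm (hν i)]
  ring

end Along

/-! ### The Gauss equation -/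

section Gauss

variable {d m : ℕ} {G : EuclideanSpace ℝ (Fin m) → Matrix (Fin m) (Fin m) ℝ}
  {x : Fin m → EuclideanSpace ℝ (Fin (d + 1)) → ℝ} {u : EuclideanSpace ℝ (Fin (d + 1))}
  {a b c e : Fin (d + 1)}

/-- The components of the coordinate vector field `∂ₐ x` along `x`. -/
def tangentAlong (x : Fin m → EuclideanSpace ℝ (Fin (d + 1)) → ℝ) (a : Fin (d + 1)) :
    Fin m → EuclideanSpace ℝ (Fin (d + 1)) → ℝ :=
  fun i => pd (x i) a

/-- The derivative `∇̄_c ∂ₐ x`. -/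
def tangentDeriv (G : EuclideanSpace ℝ (Fin m) → Matrix (Fin m) (Fin m) ℝ)
    (x : Fin m → EuclideanSpace ℝ (Fin (d + 1)) → ℝ) (c a : Fin (d + 1)) :
    Fin m → EuclideanSpace ℝ (Fin (d + 1)) → ℝ :=
  covDerivAlong G x (tangentAlong x a) c

lemma innerAlong_eq_dotProduct (ν τ : Fin m → EuclideanSpace ℝ (Fin (d + 1)) → ℝ) :
    innerAlong G x ν τ u = (fun i => ν i u) ⬝ᵥ (metricAlong G x u *ᵥ fun j => τ j u) := by
  simp only [innerAlong, dotProduct, mulVec, Finset.mul_sum]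
  exact Finset.sum_congr rfl fun _ _ => Finset.sum_congr rfl fun _ _ => by ring

lemma pullbackMetric_apply :
    pullbackMetric G x u a b = innerAlong G x (tangentAlong x a) (tangentAlong x b) u := by
  rw [innerAlong_eq_dotProduct, pullbackMetric, Matrix.mul_assoc, Matrix.mul_apply]
  rfl

lemma innerAlong_sub (ν τ₁ τ₂ : Fin m → EuclideanSpace ℝ (Fin (d + 1)) → ℝ) :
    innerAlong G x ν τ₁ u - innerAlong G x ν τ₂ u =
      ∑ i, ∑ j, metricAlong G x u i j * (ν i u * (τ₁ j u - τ₂ j u)) := by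
  simp only [innerAlong, ← Finset.sum_sub_distrib]
  exact Finset.sum_congr rfl fun _ _ => Finset.sum_congr rfl fun _ _ => by ring

lemma contDiffAt_tangentAlong (hx : ∀ i, ContDiffAt ℝ ∞ (x i) u) (i : Fin m) :
    ContDiffAt ℝ ∞ (tangentAlong x a i) u :=
  contDiffAt_pd (hx i)

lemma smoothMetricAt_pullbackMetric
    (hG : ∀ᶠ v in 𝓝 u, SmoothMetricAt G (WithLp.toLp 2 fun i => x i v))
    (hx : ∀ i, ContDiffAt ℝ ∞ (x i) u) (hg : IsUnit (pullbackMetric G x u).det) :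
    SmoothMetricAt (pullbackMetric G x) u where
  contDiffAt i j := by
    simp only [pullbackMetric_apply]
    exact contDiffAt_innerAlong hG.self_of_nhds hx (contDiffAt_tangentAlong hx)
      (contDiffAt_tangentAlong hx)
  symm := hG.mono fun v hv i j => by
    rw [pullbackMetric_apply, pullbackMetric_apply, innerAlong_comm hv]
  isUnit_det := hg

lemma pd_pullbackMetric (hG : SmoothMetricAt G (WithLp.toLp 2 fun i => x i u))
    (hx : ∀ i, ContDiffAt ℝ ∞ (x i) u) :
    pd (fun v => pullbackMetric G x v a b) c u =
      innerAlong G x (tangentAlong x b) (tangentDeriv G x c a) u +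
        innerAlong G x (tangentAlong x a) (tangentDeriv G x c b) u := by
  simp only [pullbackMetric_apply]
  rw [← innerAlong_comm hG (ν := tangentDeriv G x c a)]
  exact pd_innerAlong hG hx (contDiffAt_tangentAlong hx) (contDiffAt_tangentAlong hx)

lemma tangentDeriv_comm (hG : SmoothMetricAt G (WithLp.toLp 2 fun i => x i u))
    (hx : ∀ i, ContDiffAt ℝ ∞ (x i) u) (i : Fin m) :
    tangentDeriv G x a b i u = tangentDeriv G x b a i u :=
  covDerivAlong_pd_comm hG hx i

lemma innerAlong_tangentDeriv_comm (hG : SmoothMetricAt G (WithLp.toLp 2 fun i => x i u))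
    (hx : ∀ i, ContDiffAt ℝ ∞ (x i) u) (ν : Fin m → EuclideanSpace ℝ (Fin (d + 1)) → ℝ) :
    innerAlong G x ν (tangentDeriv G x a b) u = innerAlong G x ν (tangentDeriv G x b a) u := by
  simp only [innerAlong, tangentDeriv_comm hG hx (a := a)]

/-- The Koszul formula for the induced metric. -/
lemma christoffelLow_pullbackMetric (hG : SmoothMetricAt G (WithLp.toLp 2 fun i => x i u))
    (hx : ∀ i, ContDiffAt ℝ ∞ (x i) u) :
    christoffelLow (pullbackMetric G x) a b c u =
      innerAlong G x (tangentAlong x a) (tangentDeriv G x b c) u := by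
  simp only [christoffelLow, pd_pullbackMetric hG hx]
  rw [innerAlong_tangentDeriv_comm hG hx (a := b) (b := a),
    innerAlong_tangentDeriv_comm hG hx (a := c) (b := a),
    innerAlong_tangentDeriv_comm hG hx (a := c) (b := b)]
  ring

/-- The normal part of the inner product of `∇̄_c ∂ₐ x` and `∇̄_e ∂_b x`. -/
def normalPart (G : EuclideanSpace ℝ (Fin m) → Matrix (Fin m) (Fin m) ℝ)
    (x : Fin m → EuclideanSpace ℝ (Fin (d + 1)) → ℝ) (c a e b : Fin (d + 1))
    (u : EuclideanSpace ℝ (Fin (d + 1))) : ℝ :=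
  innerAlong G x (tangentDeriv G x c a) (tangentDeriv G x e b) u -
    ∑ s, ∑ t, innerAlong G x (tangentAlong x s) (tangentDeriv G x c a) u *
      (pullbackMetric G x u)⁻¹ s t * innerAlong G x (tangentAlong x t) (tangentDeriv G x e b) u

/-- The Koszul identity ⟨e_a, ∇̄_e e_b⟩ = g_{as} Γ^s_{eb} is differentiated along `c` in two ways.
Metric compatibility on the left gives the desired term plus ⟨∇̄_c e_a, ∇̄_e e_b⟩. On the right ∂_c
g_{as} has two halves: one yields the ΓΓ term (`h3`), the other the tangential part of that inner
product (`h4`), so only its normal part survives. -/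
lemma innerAlong_tangentAlong_covDerivAlong_tangentDeriv
    (hx : ∀ᶠ v in 𝓝 u, ∀ i, ContDiffAt ℝ ∞ (x i) v)
    (hG : ∀ᶠ v in 𝓝 u, SmoothMetricAt G (WithLp.toLp 2 fun i => x i v))
    (hg : ∀ᶠ v in 𝓝 u, IsUnit (pullbackMetric G x v).det) :
    innerAlong G x (tangentAlong x a) (covDerivAlong G x (tangentDeriv G x e b) c) u =
      ∑ s, pullbackMetric G x u a s * (pd (christoffel (pullbackMetric G x) s e b) c u +
        ∑ t, christoffel (pullbackMetric G x) s c t u * christoffel (pullbackMetric G x) t e b u)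
      - normalPart G x c a e b u := by
  have hne : (∞ : WithTop ℕ∞) ≠ 0 := by norm_num
  have hx0 := hx.self_of_nhds
  have hG0 := hG.self_of_nhds
  have hg0 := smoothMetricAt_pullbackMetric hG hx0 hg.self_of_nhds
  have hgev : ∀ᶠ v in 𝓝 u, SmoothMetricAt (pullbackMetric G x) v := by
    filter_upwards [hG.eventually_nhds, hx, hg] with v h1 h2 h3
    exact smoothMetricAt_pullbackMetric h1 h2 h3
  -- The identity is about to be differentiated, so it is needed on a neighbourhood; this is why the
  -- hypotheses are eventual.
  have hE : ∀ᶠ v in 𝓝 u, innerAlong G x (tangentAlong x a) (tangentDeriv G x e b) v =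
      ∑ s, pullbackMetric G x v a s * christoffel (pullbackMetric G x) s e b v := by
    filter_upwards [hG, hx, hgev] with v h1 h2 h3
    rw [h3.sum_mul_christoffel, christoffelLow_pullbackMetric h1 h2]
  have h1 := pd_innerAlong (a := c) hG0 hx0 (contDiffAt_tangentAlong (a := a) hx0)
    (fun i => contDiffAt_covDerivAlong (a := e) hG0 hx0 (contDiffAt_tangentAlong (a := b) hx0) i)
  have dg : ∀ s, DifferentiableAt ℝ (fun v => pullbackMetric G x v a s) u := fun s =>
    (hg0.contDiffAt a s).differentiableAt hne
  have dΓ : ∀ s, DifferentiableAt ℝ (christoffel (pullbackMetric G x) s e b) u := fun s =>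
    (hg0.contDiffAt_christoffel s e b).differentiableAt hne
  have h2 := pd_congr (a := c) hE
  rw [pd_sum fun s _ => (dg s).fun_mul (dΓ s)] at h2
  simp only [pd_mul (dg _) (dΓ _), pd_pullbackMetric hG0 hx0] at h2
  have h3 : ∑ s, pullbackMetric G x u a s *
      ∑ t, christoffel (pullbackMetric G x) s c t u * christoffel (pullbackMetric G x) t e b u =
      ∑ t, innerAlong G x (tangentAlong x a) (tangentDeriv G x c t) u *
        christoffel (pullbackMetric G x) t e b u := by
    simp only [← christoffelLow_pullbackMetric hG0 hx0, ← hg0.sum_mul_christoffel, Finset.mul_sum,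
      Finset.sum_mul]
    rw [Finset.sum_comm]
    exact Finset.sum_congr rfl fun _ _ => Finset.sum_congr rfl fun _ _ => by ring
  have h4 : ∑ s, ∑ t, innerAlong G x (tangentAlong x s) (tangentDeriv G x c a) u *
      (pullbackMetric G x u)⁻¹ s t * innerAlong G x (tangentAlong x t) (tangentDeriv G x e b) u =
      ∑ s, innerAlong G x (tangentAlong x s) (tangentDeriv G x c a) u *
        christoffel (pullbackMetric G x) s e b u := by
    simp only [christoffel_eq, christoffelLow_pullbackMetric hG0 hx0, Finset.mul_sum]
    exact Finset.sum_congr rfl fun _ _ => Finset.sum_congr rfl fun _ _ => by ring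
  rw [normalPart, h4]
  simp only [mul_add, Finset.sum_add_distrib, h3]
  simp only [add_mul, Finset.sum_add_distrib] at h2
  change _ = innerAlong G x (tangentDeriv G x c a) (tangentDeriv G x e b) u +
    innerAlong G x (tangentAlong x a) (covDerivAlong G x (tangentDeriv G x e b) c) u at h1
  change pd (innerAlong G x (tangentAlong x a) (tangentDeriv G x e b)) c u = _ at h2
  change pd (innerAlong G x (tangentAlong x a) (tangentDeriv G x e b)) c u = _ at h1
  linarith

/-- The Gauss equation. -/
lemma riemann_pullbackMetric
    (hx : ∀ᶠ v in 𝓝 u, ∀ i, ContDiffAt ℝ ∞ (x i) v)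
    (hG : ∀ᶠ v in 𝓝 u, SmoothMetricAt G (WithLp.toLp 2 fun i => x i v))
    (hg : ∀ᶠ v in 𝓝 u, IsUnit (pullbackMetric G x v).det) :
    riemann (pullbackMetric G x) a b c e u =
      (∑ i, ∑ j, ∑ k, ∑ l, riemann G i j k l (WithLp.toLp 2 fun i => x i u) *
        (jac x u i a * jac x u j b * jac x u k c * jac x u l e))
      + normalPart G x c a e b u - normalPart G x e a c b u := by
  have hx0 := hx.self_of_nhds
  have hG0 := hG.self_of_nhds
  -- Antisymmetrising the previous lemma in `c` and `e` assembles the intrinsic curvature from the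
  -- Christoffel terms, while the commutator turns the other side into the ambient curvature.
  have h1 := innerAlong_sub (G := G) (x := x) (u := u) (tangentAlong x a)
    (covDerivAlong G x (tangentDeriv G x e b) c) (covDerivAlong G x (tangentDeriv G x c b) e)
  rw [innerAlong_tangentAlong_covDerivAlong_tangentDeriv hx hG hg,
    innerAlong_tangentAlong_covDerivAlong_tangentDeriv hx hG hg] at h1
  have h2 : ∑ i, ∑ j, ∑ k, ∑ l, riemann G i j k l (WithLp.toLp 2 fun i => x i u) *
        (jac x u i a * jac x u j b * jac x u k c * jac x u l e) =
      ∑ i, ∑ j, metricAlong G x u i j * (tangentAlong x a i u *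
        (covDerivAlong G x (tangentDeriv G x e b) c j u -
          covDerivAlong G x (tangentDeriv G x c b) e j u)) := by
    refine Finset.sum_congr rfl fun i _ => ?_
    have h3 : ∀ s, covDerivAlong G x (tangentDeriv G x e b) c s u -
          covDerivAlong G x (tangentDeriv G x c b) e s u = _ := fun s =>
      covDerivAlong_commutator hG0 hx0 (contDiffAt_tangentAlong (a := b) hx0) s
    simp only [h3, riemann, Finset.mul_sum, Finset.sum_mul]
    calc _ = ∑ j, ∑ k, ∑ s, ∑ l, G (WithLp.toLp 2 fun i => x i u) i s *
          riemannUp G s j k l (WithLp.toLp 2 fun i => x i u) *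
          (jac x u i a * jac x u j b * jac x u k c * jac x u l e) :=
          Finset.sum_congr rfl fun _ _ => Finset.sum_congr rfl fun _ _ => Finset.sum_comm
      _ = _ := by
          rw [sum_rotate₃]
          refine Finset.sum_congr rfl fun s _ => Finset.sum_congr rfl fun j _ =>
            Finset.sum_congr rfl fun k _ => Finset.sum_congr rfl fun l _ => ?_
          simp only [metricAlong, jac, Matrix.of_apply, tangentAlong]
          ring
  rw [h2, ← h1, riemann]
  simp only [riemannUp, Finset.sum_sub_distrib, mul_sub, mul_add, Finset.sum_add_distrib]
  ring

variable {p : ℕ} {ν : Fin p → Fin m → EuclideanSpace ℝ (Fin (d + 1)) → ℝ}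

/-- The components `ν_A^i` of a family of vector fields along a map. -/
def frameMatrix (ν : Fin p → Fin m → EuclideanSpace ℝ (Fin (d + 1)) → ℝ)
    (u : EuclideanSpace ℝ (Fin (d + 1))) : Matrix (Fin m) (Fin p) ℝ :=
  Matrix.of fun i A => ν A i u

/-- Completeness of a tangent frame together with an orthonormal normal frame. -/
lemma completeness {E : Matrix (Fin m) (Fin (d + 1)) ℝ} {N : Matrix (Fin m) (Fin p) ℝ}
    {M : Matrix (Fin m) (Fin m) ℝ} (hm : m = d + 1 + p) (hg : IsUnit (Eᵀ * M * E).det)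
    (hEN : Eᵀ * M * N = 0) (hNE : Nᵀ * M * E = 0) (hNN : Nᵀ * M * N = 1) :
    E * (Eᵀ * M * E)⁻¹ * Eᵀ * M + N * Nᵀ * M = 1 := by
  -- The dual frame is a left inverse of the frame `(E, N)`. Since `m = d + 1 + p`, it is also a
  -- right inverse, which is the claim.
  have h : Matrix.fromRows ((Eᵀ * M * E)⁻¹ * Eᵀ * M) (Nᵀ * M) * Matrix.fromCols E N = 1 := by
    rw [Matrix.fromRows_mul_fromCols, hNE, hNN]
    have h1 : (Eᵀ * M * E)⁻¹ * Eᵀ * M * E = 1 := by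
      rw [Matrix.mul_assoc, Matrix.mul_assoc, ← Matrix.mul_assoc Eᵀ, Matrix.nonsing_inv_mul _ hg]
    have h2 : (Eᵀ * M * E)⁻¹ * Eᵀ * M * N = 0 := by
      rw [Matrix.mul_assoc, Matrix.mul_assoc, ← Matrix.mul_assoc Eᵀ, hEN, Matrix.mul_zero]
    rw [h1, h2, Matrix.fromBlocks_one]
  have h2 := (Matrix.mul_eq_one_comm_of_card_eq _ _ _ (by simp [hm])).mp h
  rw [Matrix.fromCols_mul_fromRows] at h2
  simpa only [Matrix.mul_assoc] using h2

/-- The second fundamental form `h_{ca} = -g(∇̄_c ν, ∂ₐ x)`. -/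
def secondForm (G : EuclideanSpace ℝ (Fin m) → Matrix (Fin m) (Fin m) ℝ)
    (x ν : Fin m → EuclideanSpace ℝ (Fin (d + 1)) → ℝ) (u : EuclideanSpace ℝ (Fin (d + 1))) :
    Matrix (Fin (d + 1)) (Fin (d + 1)) ℝ :=
  -((covDerivMatrix G x ν u)ᵀ * metricAlong G x u * jac x u)

/-- Weingarten's identity: differentiate ⟨ν, e_a⟩ = 0 along `c`. Normality is therefore required
near `u`, not only at `u`. -/
lemma secondForm_apply (hG : SmoothMetricAt G (WithLp.toLp 2 fun i => x i u))
    (hx : ∀ i, ContDiffAt ℝ ∞ (x i) u) {ν : Fin m → EuclideanSpace ℝ (Fin (d + 1)) → ℝ}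
    (hν : ∀ i, ContDiffAt ℝ ∞ (ν i) u)
    (hνT : ∀ᶠ v in 𝓝 u, innerAlong G x ν (tangentAlong x a) v = 0) :
    secondForm G x ν u c a = innerAlong G x ν (tangentDeriv G x c a) u := by
  have h1 := pd_innerAlong (a := c) hG hx hν (contDiffAt_tangentAlong (a := a) hx)
  rw [pd_congr (h := fun _ => 0) hνT] at h1
  have h2 : pd (fun _ : EuclideanSpace ℝ (Fin (d + 1)) => (0 : ℝ)) c u = 0 := by simp [pd]
  have h3 : secondForm G x ν u c a =
      -innerAlong G x (covDerivAlong G x ν c) (tangentAlong x a) u := by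
    rw [secondForm, innerAlong_eq_dotProduct, Matrix.mul_assoc, Matrix.neg_apply, Matrix.mul_apply]
    rfl
  rw [h3]
  change _ = _ + innerAlong G x ν (tangentDeriv G x c a) u at h1
  linarith

/-- Inserting `completeness` into ⟨∇̄_c e_a, ∇̄_e e_b⟩ yields a tangential sum, which is exactly
what `normalPart` subtracts, and a sum over the normal frame. -/
lemma normalPart_eq (hm : m = d + 1 + p) (hG : SmoothMetricAt G (WithLp.toLp 2 fun i => x i u))
    (hg : IsUnit (pullbackMetric G x u).det)
    (hνν : ∀ A B, innerAlong G x (ν A) (ν B) u = if A = B then 1 else 0)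
    (hνT : ∀ A a, innerAlong G x (ν A) (tangentAlong x a) u = 0) :
    normalPart G x c a e b u = ∑ A, innerAlong G x (ν A) (tangentDeriv G x c a) u *
      innerAlong G x (ν A) (tangentDeriv G x e b) u := by
  have h := completeness (E := jac x u) (N := frameMatrix ν u) (M := metricAlong G x u) hm hg
    (by
      ext a A
      rw [Matrix.mul_assoc, Matrix.mul_apply]
      have := hνT A a
      rw [innerAlong_comm hG, innerAlong_eq_dotProduct] at this
      exact this)
    (by
      ext A a
      rw [Matrix.mul_assoc, Matrix.mul_apply]
      have := hνT A a
      rw [innerAlong_eq_dotProduct] at this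
      exact this)
    (by
      ext A B
      rw [Matrix.mul_assoc, Matrix.mul_apply, Matrix.one_apply]
      have := hνν A B
      rw [innerAlong_eq_dotProduct] at this
      exact this)
  set X : Fin m → ℝ := fun i => tangentDeriv G x c a i u with hX
  set Y : Fin m → ℝ := fun i => tangentDeriv G x e b i u with hY
  set M := metricAlong G x u with hM
  have hMs : ∀ v w : Fin m → ℝ, v ⬝ᵥ (M *ᵥ w) = w ⬝ᵥ (M *ᵥ v) := by
    intro v w
    have hMt : Mᵀ = M := by ext i j; exact hG.apply_symm j i
    rw [Matrix.dotProduct_mulVec, ← Matrix.mulVec_transpose, hMt, dotProduct_comm]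
  have h1 : X ⬝ᵥ (M *ᵥ ((jac x u * (pullbackMetric G x u)⁻¹ * (jac x u)ᵀ * M +
      frameMatrix ν u * (frameMatrix ν u)ᵀ * M) *ᵥ Y)) = X ⬝ᵥ (M *ᵥ Y) := by
    have h' : jac x u * (pullbackMetric G x u)⁻¹ * (jac x u)ᵀ * M +
      frameMatrix ν u * (frameMatrix ν u)ᵀ * M = 1 := h
    rw [h', Matrix.one_mulVec]
  rw [normalPart]
  simp only [innerAlong_eq_dotProduct]
  rw [← h1, hMs, Matrix.add_mulVec, add_dotProduct]
  have h2 : ∀ {q : ℕ} (W : Matrix (Fin m) (Fin q) ℝ) (z : Fin q → ℝ),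
      (W *ᵥ z) ⬝ᵥ (M *ᵥ X) = ∑ s, ((fun i => W i s) ⬝ᵥ (M *ᵥ X)) * z s := by
    intro q W z
    rw [dotProduct_comm, Matrix.dotProduct_mulVec, dotProduct]
    refine Finset.sum_congr rfl fun s _ => ?_
    rw [dotProduct_comm (fun i => W i s)]
    rfl
  have h3 : (jac x u * (pullbackMetric G x u)⁻¹ * (jac x u)ᵀ * M) *ᵥ Y =
      jac x u *ᵥ ((pullbackMetric G x u)⁻¹ *ᵥ ((jac x u)ᵀ *ᵥ (M *ᵥ Y))) := by
    simp only [Matrix.mulVec_mulVec, Matrix.mul_assoc]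
  have h4 : (frameMatrix ν u * (frameMatrix ν u)ᵀ * M) *ᵥ Y =
      frameMatrix ν u *ᵥ ((frameMatrix ν u)ᵀ *ᵥ (M *ᵥ Y)) := by
    simp only [Matrix.mulVec_mulVec, Matrix.mul_assoc]
  rw [h3, h4, h2, h2]
  have h5 : ∑ s, ((fun i => jac x u i s) ⬝ᵥ (M *ᵥ X)) *
      ((pullbackMetric G x u)⁻¹ *ᵥ ((jac x u)ᵀ *ᵥ (M *ᵥ Y))) s =
      ∑ s, ∑ t, ((fun i => tangentAlong x s i u) ⬝ᵥ (M *ᵥ X)) * (pullbackMetric G x u)⁻¹ s t *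
        ((fun i => tangentAlong x t i u) ⬝ᵥ (M *ᵥ Y)) := by
    refine Finset.sum_congr rfl fun s _ => ?_
    have h6 : ∀ z : Fin (d + 1) → ℝ, ((pullbackMetric G x u)⁻¹ *ᵥ z) s =
      ∑ t, (pullbackMetric G x u)⁻¹ s t * z t := fun _ => rfl
    rw [h6, Finset.mul_sum]
    exact Finset.sum_congr rfl fun t _ => (mul_assoc _ _ _).symm
  rw [h5, add_sub_cancel_left]
  rfl

/-- The Gauss equation in terms of the second fundamental forms of a normal frame. -/
lemma riemann_pullbackMetric_eq_secondForm (hm : m = d + 1 + p)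
    (hx : ∀ᶠ v in 𝓝 u, ∀ i, ContDiffAt ℝ ∞ (x i) v)
    (hG : ∀ᶠ v in 𝓝 u, SmoothMetricAt G (WithLp.toLp 2 fun i => x i v))
    (hg : ∀ᶠ v in 𝓝 u, IsUnit (pullbackMetric G x v).det)
    (hν : ∀ A i, ContDiffAt ℝ ∞ (ν A i) u)
    (hνν : ∀ A B, innerAlong G x (ν A) (ν B) u = if A = B then 1 else 0)
    (hνT : ∀ᶠ v in 𝓝 u, ∀ A a, innerAlong G x (ν A) (tangentAlong x a) v = 0) :
    riemann (pullbackMetric G x) a b c e u =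
      (∑ i, ∑ j, ∑ k, ∑ l, riemann G i j k l (WithLp.toLp 2 fun i => x i u) *
        (jac x u i a * jac x u j b * jac x u k c * jac x u l e))
      + ∑ A, (secondForm G x (ν A) u c a * secondForm G x (ν A) u e b -
          secondForm G x (ν A) u e a * secondForm G x (ν A) u c b) := by
  have h : ∀ A c a, secondForm G x (ν A) u c a =
      innerAlong G x (ν A) (tangentDeriv G x c a) u := fun A c a =>
    secondForm_apply hG.self_of_nhds hx.self_of_nhds (hν A) (hνT.mono fun v hv => hv A a)
  rw [riemann_pullbackMetric hx hG hg, add_sub_assoc, normalPart_eq hm hG.self_of_nhds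
    hg.self_of_nhds hνν hνT.self_of_nhds, normalPart_eq hm hG.self_of_nhds
    hg.self_of_nhds hνν hνT.self_of_nhds, ← Finset.sum_sub_distrib]
  simp only [h]

end Gauss

/-! ### The Ricci curvature in coordinates -/

section Ricci

variable {d m : ℕ} {G : EuclideanSpace ℝ (Fin m) → Matrix (Fin m) (Fin m) ℝ}
  {ρ : EuclideanSpace ℝ (Fin (d + 1)) → ℝ}
  {x : Fin m → EuclideanSpace ℝ (Fin (d + 1)) → ℝ} {u : EuclideanSpace ℝ (Fin (d + 1))}
  {p : ℕ} {ν : Fin p → Fin m → EuclideanSpace ℝ (Fin (d + 1)) → ℝ}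

/-- `∑ Πⁱᵏ Πˡʳ R_{ijkl}` as a matrix in `r, j`. -/
def curvatureContraction (Q : Matrix (Fin m) (Fin m) ℝ) (R : Fin m → Fin m → Fin m → Fin m → ℝ) :
    Matrix (Fin m) (Fin m) ℝ :=
  Matrix.of fun r j => ∑ i, ∑ k, ∑ l, Q i k * Q l r * R i j k l

lemma triple_mul_transpose_apply {n : ℕ} (E : Matrix (Fin m) (Fin n) ℝ)
    (h : Matrix (Fin n) (Fin n) ℝ) (i k : Fin m) :
    (E * h * Eᵀ) i k = ∑ a, ∑ c, E i a * h a c * E k c := by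
  simp only [Matrix.mul_apply, Matrix.transpose_apply, Finset.sum_mul]
  exact Finset.sum_comm

/-- The Ricci contraction forms one projector `E * h * Eᵀ`; the second stays incomplete as `h * Eᵀ`
until the free index `q` is pushed forward by `E` or traced. -/
lemma sum_inv_mul_curvature {n : ℕ} (E : Matrix (Fin m) (Fin n) ℝ)
    (h : Matrix (Fin n) (Fin n) ℝ) (R : Fin m → Fin m → Fin m → Fin m → ℝ) (q b : Fin n) :
    ∑ a, ∑ c, ∑ e, h a c * h q e *
        (∑ i, ∑ j, ∑ k, ∑ l, R i j k l * (E i a * E j b * E k c * E l e)) =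
      ∑ i, ∑ j, ∑ k, ∑ l, (E * h * Eᵀ) i k * (h * Eᵀ) q l * R i j k l * E j b := by
  have h1 : ∀ i j k l, (E * h * Eᵀ) i k * (h * Eᵀ) q l * R i j k l * E j b =
      ∑ a, ∑ c, ∑ e, h a c * h q e * (R i j k l * (E i a * E j b * E k c * E l e)) := by
    intro i j k l
    rw [triple_mul_transpose_apply, Matrix.mul_apply, mul_assoc, mul_assoc, Finset.sum_mul]
    refine Finset.sum_congr rfl fun a _ => ?_
    rw [Finset.sum_mul]
    refine Finset.sum_congr rfl fun c _ => ?_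
    rw [Finset.sum_mul, Finset.mul_sum]
    refine Finset.sum_congr rfl fun e _ => ?_
    rw [Matrix.transpose_apply]
    ring
  simp only [h1, Finset.mul_sum]
  calc _ = ∑ a, ∑ c, ∑ i, ∑ e, ∑ j, ∑ k, ∑ l, h a c * h q e *
        (R i j k l * (E i a * E j b * E k c * E l e)) :=
        Finset.sum_congr rfl fun _ _ => Finset.sum_congr rfl fun _ _ => Finset.sum_comm
    _ = ∑ i, ∑ a, ∑ c, ∑ e, ∑ j, ∑ k, ∑ l, h a c * h q e *
        (R i j k l * (E i a * E j b * E k c * E l e)) := sum_rotate₃ _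
    _ = _ := by
        refine Finset.sum_congr rfl fun i _ => ?_
        calc _ = ∑ a, ∑ c, ∑ j, ∑ e, ∑ k, ∑ l, h a c * h q e *
              (R i j k l * (E i a * E j b * E k c * E l e)) :=
              Finset.sum_congr rfl fun _ _ => Finset.sum_congr rfl fun _ _ => Finset.sum_comm
          _ = ∑ j, ∑ a, ∑ c, ∑ e, ∑ k, ∑ l, h a c * h q e *
              (R i j k l * (E i a * E j b * E k c * E l e)) := sum_rotate₃ _
          _ = _ := by
              refine Finset.sum_congr rfl fun j _ => ?_
              calc _ = ∑ a, ∑ c, ∑ k, ∑ e, ∑ l, h a c * h q e *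
                    (R i j k l * (E i a * E j b * E k c * E l e)) :=
                    Finset.sum_congr rfl fun _ _ => Finset.sum_congr rfl fun _ _ =>
                      Finset.sum_comm
                _ = ∑ k, ∑ a, ∑ c, ∑ e, ∑ l, h a c * h q e *
                    (R i j k l * (E i a * E j b * E k c * E l e)) := sum_rotate₃ _
                _ = _ := by
                    refine Finset.sum_congr rfl fun k _ => ?_
                    calc _ = ∑ a, ∑ c, ∑ l, ∑ e, h a c * h q e *
                          (R i j k l * (E i a * E j b * E k c * E l e)) :=
                          Finset.sum_congr rfl fun _ _ => Finset.sum_congr rfl fun _ _ =>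
                            Finset.sum_comm
                      _ = _ := sum_rotate₃ _

/-- This and the next lemma contract the two quadratic terms of the Gauss equation. The index order
there already fits matrix products, so neither matrix has to be symmetric. -/
lemma sum_inv_mul_trace {n : ℕ} (h H : Matrix (Fin n) (Fin n) ℝ) (q b : Fin n) :
    ∑ a, ∑ c, ∑ e, h a c * h q e * (H c a * H e b) = (h * H).trace * (h * H) q b := by
  rw [Matrix.trace, Finset.sum_mul]
  refine Finset.sum_congr rfl fun a _ => ?_
  rw [Matrix.diag_apply, Matrix.mul_apply, Finset.sum_mul]
  refine Finset.sum_congr rfl fun c _ => ?_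
  rw [Matrix.mul_apply, Finset.mul_sum]
  exact Finset.sum_congr rfl fun e _ => by ring

lemma sum_inv_mul_sq {n : ℕ} (h H : Matrix (Fin n) (Fin n) ℝ) (q b : Fin n) :
    ∑ a, ∑ c, ∑ e, h a c * h q e * (H e a * H c b) = (h * H * (h * H)) q b := by
  simp only [Matrix.mul_apply (M := h * H), Matrix.mul_apply (M := h), Finset.sum_mul,
    Finset.mul_sum]
  refine Finset.sum_congr rfl fun a _ => Finset.sum_congr rfl fun c _ =>
    Finset.sum_congr rfl fun e _ => by ring

lemma inv_pullbackMetric_transpose (hG : SmoothMetricAt G (WithLp.toLp 2 fun i => x i u)) :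
    ((pullbackMetric G x u)⁻¹)ᵀ = (pullbackMetric G x u)⁻¹ := by
  rw [Matrix.transpose_nonsing_inv]
  congr 1
  ext a b
  rw [Matrix.transpose_apply, pullbackMetric_apply, pullbackMetric_apply, innerAlong_comm hG]

/-- The Ricci curvature of the induced metric. -/
lemma ricciMatrix_pullbackMetric (hm : m = d + 1 + p)
    (hx : ∀ᶠ v in 𝓝 u, ∀ i, ContDiffAt ℝ ∞ (x i) v)
    (hG : ∀ᶠ v in 𝓝 u, SmoothMetricAt G (WithLp.toLp 2 fun i => x i v))
    (hg : ∀ᶠ v in 𝓝 u, IsUnit (pullbackMetric G x v).det)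
    (hν : ∀ A i, ContDiffAt ℝ ∞ (ν A i) u)
    (hνν : ∀ A B, innerAlong G x (ν A) (ν B) u = if A = B then 1 else 0)
    (hνT : ∀ᶠ v in 𝓝 u, ∀ A a, innerAlong G x (ν A) (tangentAlong x a) v = 0) :
    ricciMatrix (pullbackMetric G x) u =
      Matrix.of (fun q b => ∑ i, ∑ j, ∑ k, ∑ l,
        (jac x u * (pullbackMetric G x u)⁻¹ * (jac x u)ᵀ) i k *
          ((pullbackMetric G x u)⁻¹ * (jac x u)ᵀ) q l *
          riemann G i j k l (WithLp.toLp 2 fun i => x i u) * jac x u j b) +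
      ∑ A, (((pullbackMetric G x u)⁻¹ * secondForm G x (ν A) u).trace •
          ((pullbackMetric G x u)⁻¹ * secondForm G x (ν A) u) -
        (pullbackMetric G x u)⁻¹ * secondForm G x (ν A) u *
          ((pullbackMetric G x u)⁻¹ * secondForm G x (ν A) u)) := by
  ext q b
  simp only [ricciMatrix, Matrix.of_apply,
    riemann_pullbackMetric_eq_secondForm hm hx hG hg hν hνν hνT,
    mul_add, Finset.sum_add_distrib, Matrix.add_apply, sum_inv_mul_curvature]
  congr 1
  rw [Matrix.sum_apply]
  simp only [Matrix.sub_apply, Matrix.smul_apply, smul_eq_mul, ← sum_inv_mul_trace,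
    ← sum_inv_mul_sq, ← Finset.sum_sub_distrib, ← mul_sub, Finset.mul_sum]
  calc _ = ∑ a, ∑ c, ∑ A, ∑ e, _ :=
        Finset.sum_congr rfl fun _ _ => Finset.sum_congr rfl fun _ _ => Finset.sum_comm
    _ = _ := sum_rotate₃ _

/-- `ℬ` factors through the tangent space. -/
lemma exists_mixedB_eq_jac_mul (hG : SmoothMetricAt G (WithLp.toLp 2 fun i => x i u))
    (hg : IsUnit (pullbackMetric G x u).det)
    (ν : Fin m → EuclideanSpace ℝ (Fin (d + 1)) → ℝ) :
    ∃ Z : Matrix (Fin (d + 1)) (Fin m) ℝ, mixedB G ρ x ν u = jac x u * Z ∧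
      Z * jac x u = ((pullbackMetric G x u).det / ρ u ^ 2) •
        ((pullbackMetric G x u)⁻¹ * secondForm G x ν u) := by
  -- The witness is the right-hand side of `mixedB_eq` with its left factor `jac x u` removed.
  refine ⟨(-((pullbackMetric G x u).det / ρ u ^ 2)) • ((pullbackMetric G x u)⁻¹ *
    (covDerivMatrix G x ν u)ᵀ * metricAlong G x u), ?_, ?_⟩
  · rw [mixedB_eq hg, inv_pullbackMetric_transpose hG, Matrix.mul_smul]
    simp only [Matrix.mul_assoc]
  · rw [secondForm]
    simp only [Matrix.mul_assoc, Matrix.smul_mul, Matrix.mul_neg, Matrix.neg_mul, neg_smul,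
      smul_neg]

lemma tensorP2_eq_of_smoothMetricAt (hG : SmoothMetricAt G (WithLp.toLp 2 fun i => x i u))
    (hg : IsUnit (pullbackMetric G x u).det) :
    Matrix.of (tensorP2 G ρ x u) = ((pullbackMetric G x u).det / ρ u ^ 2) •
      (jac x u * (pullbackMetric G x u)⁻¹ * (jac x u)ᵀ) := by
  ext i k
  rw [Matrix.of_apply, tensorP2_eq hg, inv_pullbackMetric_transpose hG]
  rfl

/-- The Ricci map of the induced metric, pushed forward to the ambient space. -/
theorem jac_mul_ricciMatrix (hm : m = d + 1 + p)
    (hx : ∀ᶠ v in 𝓝 u, ∀ i, ContDiffAt ℝ ∞ (x i) v)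
    (hG : ∀ᶠ v in 𝓝 u, SmoothMetricAt G (WithLp.toLp 2 fun i => x i v))
    (hg : ∀ᶠ v in 𝓝 u, IsUnit (pullbackMetric G x v).det)
    (hν : ∀ A i, ContDiffAt ℝ ∞ (ν A i) u)
    (hνν : ∀ A B, innerAlong G x (ν A) (ν B) u = if A = B then 1 else 0)
    (hνT : ∀ᶠ v in 𝓝 u, ∀ A a, innerAlong G x (ν A) (tangentAlong x a) v = 0)
    (hρ : ρ u ≠ 0) :
    jac x u * ricciMatrix (pullbackMetric G x) u =
      (1 / ((pullbackMetric G x u).det / ρ u ^ 2) ^ 2) •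
        ((curvatureContraction (Matrix.of (tensorP2 G ρ x u)) fun i j k l =>
            riemann G i j k l (WithLp.toLp 2 fun i => x i u)) +
          ∑ A, ((mixedB G ρ x (ν A) u).trace • mixedB G ρ x (ν A) u -
            mixedB G ρ x (ν A) u * mixedB G ρ x (ν A) u)) * jac x u := by
  have hG0 := hG.self_of_nhds
  have hg0 := hg.self_of_nhds
  set κ := (pullbackMetric G x u).det / ρ u ^ 2 with hκ
  have hκ0 : κ ≠ 0 := div_ne_zero hg0.ne_zero (pow_ne_zero _ hρ)
  rw [eq_comm, Matrix.smul_mul, one_div, inv_smul_eq_iff₀ (pow_ne_zero 2 hκ0),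
    ricciMatrix_pullbackMetric hm hx hG hg hν hνν hνT, Matrix.add_mul, Matrix.mul_add, smul_add]
  set g := pullbackMetric G x u with hgdef
  set E := jac x u with hE
  -- Pushing forward by `E` produces the projector with indices `r l`, while the contraction in the
  -- statement has `l r`.
  have hsymm : (E * g⁻¹ * Eᵀ)ᵀ = E * g⁻¹ * Eᵀ := by
    rw [Matrix.transpose_mul, Matrix.transpose_mul, Matrix.transpose_transpose,
      inv_pullbackMetric_transpose hG0, Matrix.mul_assoc]
  congr 1
  · rw [tensorP2_eq_of_smoothMetricAt hG0 hg0, ← hκ]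
    ext r b
    rw [Matrix.mul_apply, Matrix.smul_apply, Matrix.mul_apply, smul_eq_mul]
    simp only [curvatureContraction, Matrix.of_apply, Matrix.smul_apply, smul_eq_mul,
      Finset.sum_mul]
    have h1 : ∀ l, (E * g⁻¹ * Eᵀ) l r = ∑ q, E r q * (g⁻¹ * Eᵀ) q l := by
      intro l
      rw [← Matrix.mul_apply, ← Matrix.mul_assoc, ← Matrix.transpose_apply (E * g⁻¹ * Eᵀ), hsymm]
    have h2 : ∑ q, E r q * ∑ i, ∑ j, ∑ k, ∑ l, (E * g⁻¹ * Eᵀ) i k * (g⁻¹ * Eᵀ) q l *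
          riemann G i j k l (WithLp.toLp 2 fun i => x i u) * E j b =
        ∑ i, ∑ j, ∑ k, ∑ l, (E * g⁻¹ * Eᵀ) i k * (E * g⁻¹ * Eᵀ) l r *
          riemann G i j k l (WithLp.toLp 2 fun i => x i u) * E j b := by
      simp only [Finset.mul_sum]
      rw [Finset.sum_comm]
      refine Finset.sum_congr rfl fun i _ => ?_
      rw [Finset.sum_comm]
      refine Finset.sum_congr rfl fun j _ => ?_
      rw [Finset.sum_comm]
      refine Finset.sum_congr rfl fun k _ => ?_
      rw [Finset.sum_comm]
      refine Finset.sum_congr rfl fun l _ => ?_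
      rw [h1, Finset.mul_sum, Finset.sum_mul, Finset.sum_mul]
      exact Finset.sum_congr rfl fun q _ => by ring
    rw [h2, Finset.sum_comm]
    simp only [Finset.mul_sum]
    exact Finset.sum_congr rfl fun _ _ => Finset.sum_congr rfl fun _ _ =>
      Finset.sum_congr rfl fun _ _ => Finset.sum_congr rfl fun _ _ => by ring
  · rw [Matrix.sum_mul, Matrix.mul_sum, Finset.smul_sum]
    refine Finset.sum_congr rfl fun A _ => ?_
    -- With ℬ = E Z, both tr(E Z) = tr(Z E) and (E Z)² E = E (Z E)² reduce to Z E = κ g⁻¹ h. The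
    -- terms are quadratic in ℬ, which accounts for κ².
    obtain ⟨Z, hB, hZ⟩ := exists_mixedB_eq_jac_mul (ρ := ρ) hG0 hg0 (ν A)
    rw [← hκ, ← hgdef, ← hE] at hZ
    rw [hB, ← hE, Matrix.trace_mul_comm, hZ, Matrix.trace_smul, Matrix.sub_mul, Matrix.smul_mul,
      Matrix.mul_assoc, hZ]
    have h3 : E * Z * (E * Z) * E = E * ((Z * E) * (Z * E)) := by simp only [Matrix.mul_assoc]
    rw [h3, hZ, Matrix.mul_smul, Matrix.mul_sub, Matrix.mul_smul, smul_sub]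
    simp only [Matrix.smul_mul, Matrix.mul_smul, smul_smul, smul_eq_mul]
    congr 2 <;> ring

/-- The scalar curvature of the induced metric. -/
theorem trace_ricciMatrix (hm : m = d + 1 + p)
    (hx : ∀ᶠ v in 𝓝 u, ∀ i, ContDiffAt ℝ ∞ (x i) v)
    (hG : ∀ᶠ v in 𝓝 u, SmoothMetricAt G (WithLp.toLp 2 fun i => x i v))
    (hg : ∀ᶠ v in 𝓝 u, IsUnit (pullbackMetric G x v).det)
    (hν : ∀ A i, ContDiffAt ℝ ∞ (ν A i) u)
    (hνν : ∀ A B, innerAlong G x (ν A) (ν B) u = if A = B then 1 else 0)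
    (hνT : ∀ᶠ v in 𝓝 u, ∀ A a, innerAlong G x (ν A) (tangentAlong x a) v = 0)
    (hρ : ρ u ≠ 0) :
    (ricciMatrix (pullbackMetric G x) u).trace =
      (1 / ((pullbackMetric G x u).det / ρ u ^ 2) ^ 2) *
        ((∑ i, ∑ j, ∑ k, ∑ l, tensorP2 G ρ x u i k * tensorP2 G ρ x u j l *
            riemann G i j k l (WithLp.toLp 2 fun i => x i u)) +
          ∑ A, ((mixedB G ρ x (ν A) u).trace ^ 2 - (mixedB G ρ x (ν A) u ^ 2).trace)) := by
  have hG0 := hG.self_of_nhds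
  have hg0 := hg.self_of_nhds
  set κ := (pullbackMetric G x u).det / ρ u ^ 2 with hκ
  have hκ0 : κ ≠ 0 := div_ne_zero hg0.ne_zero (pow_ne_zero _ hρ)
  rw [eq_comm, one_div, inv_mul_eq_iff_eq_mul₀ (pow_ne_zero 2 hκ0),
    ricciMatrix_pullbackMetric hm hx hG hg hν hνν hνT, Matrix.trace_add, mul_add,
    Matrix.trace_sum, Finset.mul_sum]
  set g := pullbackMetric G x u with hgdef
  set E := jac x u with hE
  congr 1
  · have h0 : ∀ i k, tensorP2 G ρ x u i k = κ * (E * g⁻¹ * Eᵀ) i k := fun i k =>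
      congrFun (congrFun (tensorP2_eq_of_smoothMetricAt (ρ := ρ) hG0 hg0) i) k
    have h1 : ∀ j l, (E * g⁻¹ * Eᵀ) j l = ∑ b, (g⁻¹ * Eᵀ) b l * E j b := by
      intro j l
      rw [Matrix.mul_assoc, Matrix.mul_apply]
      exact Finset.sum_congr rfl fun _ _ => mul_comm _ _
    simp only [h0, Matrix.trace, Matrix.diag_apply, Matrix.of_apply]
    have h2 : ∑ b, ∑ i, ∑ j, ∑ k, ∑ l, (E * g⁻¹ * Eᵀ) i k * (g⁻¹ * Eᵀ) b l *
          riemann G i j k l (WithLp.toLp 2 fun i => x i u) * E j b =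
        ∑ i, ∑ j, ∑ k, ∑ l, (E * g⁻¹ * Eᵀ) i k * (E * g⁻¹ * Eᵀ) j l *
          riemann G i j k l (WithLp.toLp 2 fun i => x i u) := by
      rw [Finset.sum_comm]
      refine Finset.sum_congr rfl fun i _ => ?_
      rw [Finset.sum_comm]
      refine Finset.sum_congr rfl fun j _ => ?_
      rw [Finset.sum_comm]
      refine Finset.sum_congr rfl fun k _ => ?_
      rw [Finset.sum_comm]
      refine Finset.sum_congr rfl fun l _ => ?_
      rw [h1 j l, Finset.mul_sum, Finset.sum_mul]
      exact Finset.sum_congr rfl fun b _ => by ring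
    rw [h2]
    simp only [Finset.mul_sum]
    exact Finset.sum_congr rfl fun _ _ => Finset.sum_congr rfl fun _ _ =>
      Finset.sum_congr rfl fun _ _ => Finset.sum_congr rfl fun _ _ => by ring
  · refine Finset.sum_congr rfl fun A _ => ?_
    obtain ⟨Z, hB, hZ⟩ := exists_mixedB_eq_jac_mul (ρ := ρ) hG0 hg0 (ν A)
    rw [← hκ, ← hgdef, ← hE] at hZ
    have h3 : (E * Z * (E * Z)).trace = ((Z * E) * (Z * E)).trace := by
      rw [Matrix.mul_assoc, Matrix.trace_mul_comm]
      simp only [Matrix.mul_assoc]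
    rw [hB, ← hE, sq (E * Z), h3, Matrix.trace_mul_comm, hZ]
    simp only [Matrix.smul_mul, Matrix.mul_smul, smul_smul, smul_eq_mul, Matrix.trace_smul,
      Matrix.trace_sub]
    ring

end Ricci

/-! ### Charts and tangent vectors -/

section Charts

variable {m : ℕ} {M : Type*} [TopologicalSpace M] [ChartedSpace (EuclideanSpace ℝ (Fin m)) M]
  {φ : OpenPartialHomeomorph M (EuclideanSpace ℝ (Fin m))} {y : M}

lemma mdifferentiable_of_mem_maximalAtlas (hφ : φ ∈ IsManifold.maximalAtlas (𝓡 m) ∞ M) :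
    φ.MDifferentiable (𝓡 m) (𝓡 m) :=
  ⟨(contMDiffOn_of_mem_maximalAtlas hφ).mdifferentiableOn (by norm_num),
    (contMDiffOn_symm_of_mem_maximalAtlas hφ).mdifferentiableOn (by norm_num)⟩

/-- `ContinuousLinearMap.inverse` is zero on non-invertible maps; on the chart domain the
differential is an equivalence, so `coordVec` is the true coordinate vector. -/
lemma mfderiv_inverse_eq (hφ : φ ∈ IsManifold.maximalAtlas (𝓡 m) ∞ M) (hy : y ∈ φ.source) :
    (mfderiv (𝓡 m) (𝓡 m) φ y).inverse =
      (((mdifferentiable_of_mem_maximalAtlas hφ).mfderiv hy).symm :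
        TangentSpace (𝓡 m) (φ y) →L[ℝ] TangentSpace (𝓡 m) y) :=
  ContinuousLinearMap.inverse_equiv ((mdifferentiable_of_mem_maximalAtlas hφ).mfderiv hy)

lemma coordVec_eq (hφ : φ ∈ IsManifold.maximalAtlas (𝓡 m) ∞ M) (hy : y ∈ φ.source) (i : Fin m) :
    coordVec φ y i = mfderiv (𝓡 m) (𝓡 m) φ.symm (φ y)
      (show TangentSpace (𝓡 m) (φ y) from EuclideanSpace.single i (1 : ℝ)) := by
  rw [coordVec, mfderiv_inverse_eq hφ hy]
  rfl

lemma mfderiv_coordVec (hφ : φ ∈ IsManifold.maximalAtlas (𝓡 m) ∞ M) (hy : y ∈ φ.source)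
    (i : Fin m) : mfderiv (𝓡 m) (𝓡 m) φ y (coordVec φ y i) =
      (show TangentSpace (𝓡 m) (φ y) from EuclideanSpace.single i (1 : ℝ)) := by
  rw [coordVec, mfderiv_inverse_eq hφ hy]
  exact ((mdifferentiable_of_mem_maximalAtlas hφ).mfderiv hy).apply_symm_apply _

lemma comp_add (v w : TangentSpace (𝓡 m) y) (i : Fin m) :
    comp φ y (v + w) i = comp φ y v i + comp φ y w i := by
  simp only [comp, map_add]
  rfl

lemma comp_smul (c : ℝ) (v : TangentSpace (𝓡 m) y) (i : Fin m) :
    comp φ y (c • v) i = c * comp φ y v i := by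
  simp only [comp, map_smul]
  rfl

/-- `comp` as a linear map. -/
def compLinear (φ : OpenPartialHomeomorph M (EuclideanSpace ℝ (Fin m))) (y : M) (i : Fin m) :
    TangentSpace (𝓡 m) y →ₗ[ℝ] ℝ where
  toFun v := comp φ y v i
  map_add' v w := comp_add v w i
  map_smul' c v := comp_smul c v i

lemma comp_sub (v w : TangentSpace (𝓡 m) y) (i : Fin m) :
    comp φ y (v - w) i = comp φ y v i - comp φ y w i :=
  map_sub (compLinear φ y i) v w

lemma comp_sum {ι : Type*} (s : Finset ι) (v : ι → TangentSpace (𝓡 m) y) (i : Fin m) :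
    comp φ y (∑ k ∈ s, v k) i = ∑ k ∈ s, comp φ y (v k) i :=
  map_sum (compLinear φ y i) v s

lemma comp_coordVec (hφ : φ ∈ IsManifold.maximalAtlas (𝓡 m) ∞ M) (hy : y ∈ φ.source)
    (i j : Fin m) : comp φ y (coordVec φ y i) j = if j = i then 1 else 0 := by
  rw [comp, mfderiv_coordVec hφ hy]
  exact PiLp.single_apply 2 ℝ i 1 j

lemma comp_ext (hφ : φ ∈ IsManifold.maximalAtlas (𝓡 m) ∞ M) (hy : y ∈ φ.source)
    {v w : TangentSpace (𝓡 m) y} (h : ∀ i, comp φ y v i = comp φ y w i) : v = w := by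
  apply (mdifferentiable_of_mem_maximalAtlas hφ).mfderiv_injective hy
  exact PiLp.ext h

lemma sum_comp_smul_coordVec (hφ : φ ∈ IsManifold.maximalAtlas (𝓡 m) ∞ M) (hy : y ∈ φ.source)
    (v : TangentSpace (𝓡 m) y) : ∑ i, comp φ y v i • coordVec φ y i = v := by
  refine comp_ext hφ hy fun j => ?_
  simp [comp_sum, comp_smul, comp_coordVec hφ hy]

lemma comp_tangentEnd (hφ : φ ∈ IsManifold.maximalAtlas (𝓡 m) ∞ M) (hy : y ∈ φ.source)
    (A : Matrix (Fin m) (Fin m) ℝ) (v : TangentSpace (𝓡 m) y) (i : Fin m) :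
    comp φ y (tangentEnd φ y A v) i = (A *ᵥ comp φ y v) i := by
  simp only [tangentEnd, comp_sum, comp_smul, comp_coordVec hφ hy, mul_ite, mul_one, mul_zero,
    Finset.sum_ite_eq, Finset.mem_univ, if_true]
  rfl

lemma metricInChart_apply (g : (y : M) → TangentSpace (𝓡 m) y → TangentSpace (𝓡 m) y → ℝ)
    (hy : y ∈ φ.source) (i j : Fin m) :
    metricInChart φ g (φ y) i j = g y (coordVec φ y i) (coordVec φ y j) := by
  rw [metricInChart, Matrix.of_apply, φ.left_inv hy]

/-- A bilinear form in the frame of coordinate vectors. -/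
lemma bilin_eq_sum (hφ : φ ∈ IsManifold.maximalAtlas (𝓡 m) ∞ M) (hy : y ∈ φ.source)
    (b : TangentSpace (𝓡 m) y →ₗ[ℝ] TangentSpace (𝓡 m) y →ₗ[ℝ] ℝ) (v w : TangentSpace (𝓡 m) y) :
    b v w = ∑ i, ∑ j, b (coordVec φ y i) (coordVec φ y j) * (comp φ y v i * comp φ y w j) := by
  conv_lhs => rw [← sum_comp_smul_coordVec hφ hy v, ← sum_comp_smul_coordVec hφ hy w]
  simp only [map_sum, map_smul, LinearMap.sum_apply, LinearMap.smul_apply, smul_eq_mul,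
    Finset.mul_sum]
  rw [Finset.sum_comm]
  exact Finset.sum_congr rfl fun _ _ => Finset.sum_congr rfl fun _ _ => by ring

/-- The Gram matrix of a positive form on a linearly independent family is positive definite. -/
lemma det_gram_pos (hφ : φ ∈ IsManifold.maximalAtlas (𝓡 m) ∞ M) (hy : y ∈ φ.source)
    (b : TangentSpace (𝓡 m) y →ₗ[ℝ] TangentSpace (𝓡 m) y →ₗ[ℝ] ℝ)
    (hsymm : ∀ v w, b v w = b w v) (hpos : ∀ v, v ≠ 0 → 0 < b v v) :
    0 < (Matrix.of fun i j => b (coordVec φ y i) (coordVec φ y j)).det := by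
  refine (Matrix.PosDef.of_dotProduct_mulVec_pos ?_ fun c hc => ?_).det_pos
  · ext i j
    exact hsymm _ _
  · set v : TangentSpace (𝓡 m) y := ∑ i, c i • coordVec φ y i with hv
    have hcomp : ∀ i, comp φ y v i = c i := fun i => by
      simp [hv, comp_sum, comp_smul, comp_coordVec hφ hy]
    have hv0 : v ≠ 0 := by
      intro h0
      apply hc
      ext i
      rw [← hcomp, h0]
      exact map_zero (compLinear φ y i)
    have h := hpos v hv0
    rw [bilin_eq_sum hφ hy] at h
    simp only [hcomp] at h
    refine lt_of_lt_of_eq h ?_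
    simp only [dotProduct, mulVec, Finset.mul_sum, Matrix.of_apply, Pi.star_apply, star_trivial]
    exact Finset.sum_congr rfl fun _ _ => Finset.sum_congr rfl fun _ _ => by ring

end Charts

/-! ### Immersions -/

section Immersion

variable {m n : ℕ} {M : Type*} [TopologicalSpace M] [ChartedSpace (EuclideanSpace ℝ (Fin m)) M]
  {S : Type*} [TopologicalSpace S] [ChartedSpace (EuclideanSpace ℝ (Fin n)) S]
  {f : S → M}

/-- In adapted charts an immersion is the injective linear map v ↦ (v, 0), up to a linear
equivalence; differentiate β ∘ f = L ∘ α, where the differential of α is injective. -/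
lemma mfderiv_injective_of_isImmersion (hf : Manifold.IsImmersion (𝓡 n) (𝓡 m) ∞ f)
    (hsm : ContMDiff (𝓡 n) (𝓡 m) ∞ f) (x : S) :
    Function.Injective (mfderiv (𝓡 n) (𝓡 m) f x) := by
  have h := hf.isImmersionAt x
  set α := h.domChart
  set β := h.codChart
  have hα := mdifferentiable_of_mem_maximalAtlas h.domChart_mem_maximalAtlas
  have hβ := mdifferentiable_of_mem_maximalAtlas h.codChart_mem_maximalAtlas
  have hxα : x ∈ α.source := h.mem_domChart_source
  have hxβ : f x ∈ β.source := h.mem_codChart_source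
  let L : EuclideanSpace ℝ (Fin n) →L[ℝ] EuclideanSpace ℝ (Fin m) :=
    (h.equiv : _ →L[ℝ] EuclideanSpace ℝ (Fin m)).comp
      (ContinuousLinearMap.inl ℝ (EuclideanSpace ℝ (Fin n)) h.complement)
  have hL : Function.Injective L := fun v w hvw => by
    have := h.equiv.injective hvw
    exact congrArg Prod.fst this
  have hev : β ∘ f =ᶠ[𝓝 x] L ∘ α := by
    filter_upwards [α.open_source.mem_nhds hxα] with z hz
    have h1 := h.writtenInCharts (show α z ∈ (h.domChart.extend (𝓡 n)).target by
      rw [OpenPartialHomeomorph.extend_target]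
      simpa using α.map_source hz)
    simp only [Function.comp_apply, OpenPartialHomeomorph.extend_coe,
      OpenPartialHomeomorph.extend_coe_symm, modelWithCornersSelf_coe,
      modelWithCornersSelf_coe_symm,
      id] at h1
    rw [α.left_inv hz] at h1
    exact h1
  have hfx : MDifferentiableAt (𝓡 n) (𝓡 m) f x := hsm.mdifferentiableAt (by norm_num)
  have h1 : mfderiv (𝓡 n) (𝓡 m) (β ∘ f) x = _ :=
    mfderiv_comp x (hβ.mdifferentiableAt hxβ) hfx
  have h2 : mfderiv (𝓡 n) (𝓡 m) (L ∘ α) x = _ :=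
    mfderiv_comp x (I' := 𝓡 n) (L.mdifferentiableAt) (hα.mdifferentiableAt hxα)
  rw [hev.mfderiv_eq, h2, ContinuousLinearMap.mfderiv_eq] at h1
  intro v w hvw
  apply hα.mfderiv_injective hxα
  apply hL
  have h3 := fun z => congrArg (fun K => K z) h1
  exact (h3 v).trans ((congrArg _ hvw).trans (h3 w).symm)

/-- The coordinates of `df (∂ₐ)` are the partial derivatives of the embedding functions. -/
lemma comp_mfderiv_coordVec {φ : OpenPartialHomeomorph M (EuclideanSpace ℝ (Fin m))}
    {ψ : OpenPartialHomeomorph S (EuclideanSpace ℝ (Fin n))}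
    (hφ : φ ∈ IsManifold.maximalAtlas (𝓡 m) ∞ M) (hψ : ψ ∈ IsManifold.maximalAtlas (𝓡 n) ∞ S)
    (hsm : ContMDiff (𝓡 n) (𝓡 m) ∞ f) {y : S} (hy : y ∈ ψ.source) (hfy : f y ∈ φ.source)
    (i : Fin m) (a : Fin n) :
    comp φ (f y) (mfderiv (𝓡 n) (𝓡 m) f y (coordVec ψ y a)) i =
      pd (embCoord φ ψ f i) a (ψ y) := by
  have dφ := (mdifferentiable_of_mem_maximalAtlas hφ).mdifferentiableAt hfy
  have dψ := (mdifferentiable_of_mem_maximalAtlas hψ).mdifferentiableAt_symm (ψ.map_source hy)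
  have df : MDifferentiableAt (𝓡 n) (𝓡 m) f (ψ.symm (ψ y)) := hsm.mdifferentiableAt (by norm_num)
  have dφ' : MDifferentiableAt (𝓡 m) (𝓡 m) φ (f (ψ.symm (ψ y))) := by rwa [ψ.left_inv hy]
  have h1 : mfderiv (𝓡 n) (𝓡 m) (φ ∘ f ∘ ψ.symm) (ψ y) = _ :=
    mfderiv_comp (ψ y) (I' := 𝓡 m) dφ' (df.comp (ψ y) dψ)
  have h2 : mfderiv (𝓡 n) (𝓡 m) (f ∘ ψ.symm) (ψ y) = _ := mfderiv_comp (ψ y) df dψ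
  have hd : MDifferentiableAt (𝓡 n) (𝓡 m) (φ ∘ f ∘ ψ.symm) (ψ y) :=
    dφ'.comp (ψ y) (df.comp (ψ y) dψ)
  rw [h2] at h1
  rw [mfderiv_eq_fderiv] at h1
  have h3 : pd (embCoord φ ψ f i) a (ψ y) =
      fderiv ℝ (φ ∘ f ∘ ψ.symm) (ψ y) (EuclideanSpace.single a 1) i := by
    have := ((EuclideanSpace.proj i : EuclideanSpace ℝ (Fin m) →L[ℝ] ℝ).hasFDerivAt.comp (ψ y)
      hd.differentiableAt.hasFDerivAt).fderiv
    rw [pd]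
    exact congrArg (fun K => K (EuclideanSpace.single a 1)) this
  rw [h3, h1, comp, coordVec_eq hψ hy]
  simp only [Function.comp_apply]
  rw [ψ.left_inv hy]
  rfl

end Immersion

/-! ### Smoothness of the coordinate expressions -/

section Smoothness

variable {m : ℕ} {M : Type*} [TopologicalSpace M] [ChartedSpace (EuclideanSpace ℝ (Fin m)) M]
  [IsManifold (𝓡 m) ∞ M] {φ : OpenPartialHomeomorph M (EuclideanSpace ℝ (Fin m))}

/-- The coordinate field is the image of a constant section under the tangent map of `φ.symm`, which
is smooth over `φ.target`. -/
lemma contMDiffAt_coordVec (hφ : φ ∈ IsManifold.maximalAtlas (𝓡 m) ∞ M)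
    {u : EuclideanSpace ℝ (Fin m)} (hu : u ∈ φ.target) (i : Fin m) :
    ContMDiffAt (𝓡 m) (𝓡 m).tangent ∞
      (fun v => (⟨φ.symm v, coordVec φ (φ.symm v) i⟩ : TangentBundle (𝓡 m) M)) u := by
  have h1 := (contMDiffOn_symm_of_mem_maximalAtlas hφ).contMDiffOn_tangentMapWithin (m := ∞)
    (by norm_num) φ.open_target.uniqueMDiffOn
  have h2 : ContMDiffAt (𝓡 m) (𝓡 m).tangent ∞
      (fun v => (⟨v, EuclideanSpace.single i (1 : ℝ)⟩ :
        TangentBundle (𝓡 m) (EuclideanSpace ℝ (Fin m)))) u := by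
    apply Bundle.contMDiffAt_totalSpace.2
    refine ⟨contMDiffAt_id, ?_⟩
    have hc : ContMDiffAt (𝓡 m) 𝓘(ℝ, EuclideanSpace ℝ (Fin m)) ∞
      (fun _ : EuclideanSpace ℝ (Fin m) => EuclideanSpace.single i (1 : ℝ)) u := contMDiffAt_const
    simpa using hc
  have h3 : ContMDiffAt (𝓡 m).tangent (𝓡 m).tangent ∞ (tangentMapWithin (𝓡 m) (𝓡 m) φ.symm φ.target)
      (⟨u, EuclideanSpace.single i (1 : ℝ)⟩ : TangentBundle (𝓡 m) (EuclideanSpace ℝ (Fin m))) :=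
    (h1 _ hu).contMDiffAt ((φ.open_target.preimage
      (FiberBundle.continuous_proj (EuclideanSpace ℝ (Fin m))
        (TangentSpace (𝓡 m) (M := EuclideanSpace ℝ (Fin m))))).mem_nhds hu)
  refine (h3.comp u h2).congr_of_eventuallyEq ?_
  filter_upwards [φ.open_target.mem_nhds hu] with v hv
  have h4 : coordVec φ (φ.symm v) i = mfderivWithin (𝓡 m) (𝓡 m) φ.symm φ.target v
      (show TangentSpace (𝓡 m) v from EuclideanSpace.single i (1 : ℝ)) := by
    rw [coordVec_eq hφ (φ.map_target hv), mfderivWithin_of_isOpen φ.open_target hv, φ.right_inv hv]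
  rw [h4]
  rfl

lemma contDiffAt_metricInChart (gbar : Bundle.ContMDiffRiemannianMetric (𝓡 m) ∞
      (EuclideanSpace ℝ (Fin m)) (fun y : M => TangentSpace (𝓡 m) y))
    (hφ : φ ∈ IsManifold.maximalAtlas (𝓡 m) ∞ M)
    {u : EuclideanSpace ℝ (Fin m)} (hu : u ∈ φ.target) (i j : Fin m) :
    ContDiffAt ℝ ∞ (fun v => metricInChart φ (fun y v w => gbar.inner y v w) v i j) u := by
  have hb : ContMDiffAt (𝓡 m) (𝓡 m) ∞ φ.symm u :=
    contMDiffAt_symm_of_mem_maximalAtlas hφ hu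
  have : ContMDiffAt (𝓡 m) ((𝓡 m).prod 𝓘(ℝ)) ∞
      (fun v => Bundle.TotalSpace.mk' ℝ (E := Bundle.Trivial M ℝ) (φ.symm v)
        (gbar.inner (φ.symm v) (coordVec φ (φ.symm v) i) (coordVec φ (φ.symm v) j))) u := by
    apply ContMDiffAt.clm_bundle_apply₂ (F₁ := EuclideanSpace ℝ (Fin m))
      (F₂ := EuclideanSpace ℝ (Fin m))
    · exact ContMDiffAt.comp u gbar.contMDiff.contMDiffAt hb
    · exact contMDiffAt_coordVec hφ hu i
    · exact contMDiffAt_coordVec hφ hu j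
  simp only [Bundle.contMDiffAt_totalSpace] at this
  exact this.2.contDiffAt

/-- Components are read off by applying the tangent map of `φ` and projecting to the fibre of the
trivial tangent bundle of the model space. -/
lemma contDiffAt_comp_of_contMDiffAt {n : ℕ} (hφ : φ ∈ IsManifold.maximalAtlas (𝓡 m) ∞ M)
    {h : EuclideanSpace ℝ (Fin n) → M}
    {V : (u : EuclideanSpace ℝ (Fin n)) → TangentSpace (𝓡 m) (h u)}
    {u : EuclideanSpace ℝ (Fin n)} (hu : h u ∈ φ.source)
    (hV : ContMDiffAt (𝓡 n) (𝓡 m).tangent ∞ (fun u => (⟨h u, V u⟩ : TangentBundle (𝓡 m) M)) u)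
    (i : Fin m) : ContDiffAt ℝ ∞ (fun v => comp φ (h v) (V v) i) u := by
  have h1 := (contMDiffOn_of_mem_maximalAtlas hφ).contMDiffOn_tangentMapWithin (m := ∞)
    (by norm_num) φ.open_source.uniqueMDiffOn
  have h3 : ContMDiffAt (𝓡 m).tangent (𝓡 m).tangent ∞ (tangentMapWithin (𝓡 m) (𝓡 m) φ φ.source)
      (⟨h u, V u⟩ : TangentBundle (𝓡 m) M) :=
    (h1 _ hu).contMDiffAt ((φ.open_source.preimage
      (FiberBundle.continuous_proj _ (TangentSpace (𝓡 m)))).mem_nhds hu)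
  have hh : ContinuousAt h u :=
    ((FiberBundle.continuous_proj (EuclideanSpace ℝ (Fin m))
      (TangentSpace (𝓡 m) (M := M))).continuousAt.comp hV.continuousAt)
  have h4 := ((contMDiff_snd_tangentBundle_modelSpace (EuclideanSpace ℝ (Fin m)) (𝓡 m)
    (n := ∞)).contMDiffAt.comp u (h3.comp u hV)).contDiffAt
  have h5 : ContDiffAt ℝ ∞ (fun v => (show EuclideanSpace ℝ (Fin m) from
      mfderiv (𝓡 m) (𝓡 m) φ (h v) (V v))) u := by
    refine h4.congr_of_eventuallyEq ?_
    filter_upwards [hh.preimage_mem_nhds (φ.open_source.mem_nhds hu)] with v hv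
    change _ = mfderivWithin (𝓡 m) (𝓡 m) φ φ.source (h v) (V v)
    rw [mfderivWithin_of_isOpen φ.open_source hv]
  exact contDiffAt_piLp 2 |>.mp h5 i

end Smoothness

/-! ### Locality of the curvature -/

section Locality

variable {n : ℕ} {g g' : EuclideanSpace ℝ (Fin n) → Matrix (Fin n) (Fin n) ℝ}
  {u : EuclideanSpace ℝ (Fin n)}

/-- The chart metric of the submanifold is known to be `pullbackMetric` only where `f` lands in the
domain of `φ`, so curvature has to depend on the germ of the metric alone. -/
lemma christoffel_congr (h : g =ᶠ[𝓝 u] g') (i j k : Fin n) :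
    christoffel g i j k u = christoffel g' i j k u := by
  have h1 : ∀ i j, (fun v => g v i j) =ᶠ[𝓝 u] fun v => g' v i j := fun i j =>
    h.mono fun v hv => congrFun (congrFun hv i) j
  simp only [christoffel, h.eq_of_nhds, pd_congr (h1 _ _)]

lemma riemannUp_congr (h : g =ᶠ[𝓝 u] g') (i j k l : Fin n) :
    riemannUp g i j k l u = riemannUp g' i j k l u := by
  have h1 : ∀ i j k, christoffel g i j k =ᶠ[𝓝 u] christoffel g' i j k := fun i j k =>
    h.eventuallyEq_nhds.mono fun v hv => christoffel_congr hv i j k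
  simp only [riemannUp, pd_congr (h1 _ _ _), (h1 _ _ _).eq_of_nhds]

lemma ricciMatrix_congr (h : g =ᶠ[𝓝 u] g') : ricciMatrix g u = ricciMatrix g' u := by
  simp only [ricciMatrix, riemann, riemannUp_congr h, h.eq_of_nhds]

end Locality

/-! ### The coordinate expressions of a submanifold -/

section Embedding

variable {X Y : Type*} [TopologicalSpace X] [TopologicalSpace Y] {m n : ℕ}

lemma toLp_embCoord {φ : OpenPartialHomeomorph Y (EuclideanSpace ℝ (Fin m))}
    {ψ : OpenPartialHomeomorph X (EuclideanSpace ℝ (Fin n))} {f : X → Y} {y : X}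
    (hy : y ∈ ψ.source) :
    (WithLp.toLp 2 fun i => embCoord φ ψ f i (ψ y) : EuclideanSpace ℝ (Fin m)) = φ (f y) := by
  simp only [embCoord, ψ.left_inv hy]

end Embedding

section EmbeddingCharts

variable {m : ℕ} {M : Type*} [TopologicalSpace M] [ChartedSpace (EuclideanSpace ℝ (Fin m)) M]
  {φ : OpenPartialHomeomorph M (EuclideanSpace ℝ (Fin m))}

lemma comp_sum_smul_coordVec (hφ : φ ∈ IsManifold.maximalAtlas (𝓡 m) ∞ M) {y : M}
    (hy : y ∈ φ.source) (Q : Fin m → Fin m → ℝ) (R : Fin m → Fin m → Fin m → Fin m → ℝ)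
    (v : TangentSpace (𝓡 m) y) (r : Fin m) :
    comp φ y (∑ i, ∑ j, ∑ k, ∑ l, ∑ r, (Q i k * Q l r * R i j k l * comp φ y v j) •
      coordVec φ y r) r = (curvatureContraction (Matrix.of Q) R *ᵥ comp φ y v) r := by
  simp only [comp_sum, comp_smul, comp_coordVec hφ hy, mul_ite, mul_one, mul_zero,
    Finset.sum_ite_eq, Finset.mem_univ, if_true]
  rw [Finset.sum_comm]
  refine Finset.sum_congr rfl fun j _ => ?_
  simp only [curvatureContraction, Matrix.of_apply, Finset.sum_mul]

variable {d : ℕ} {S : Type*} [TopologicalSpace S]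
  {f : S → M} {ψ : OpenPartialHomeomorph S (EuclideanSpace ℝ (Fin (d + 1)))} {y : S}

lemma alongCoord_apply (N : (x : S) → TangentSpace (𝓡 m) (f x)) (hy : y ∈ ψ.source) (i : Fin m) :
    alongCoord φ ψ f N i (ψ y) = comp φ (f y) (N y) i := by
  -- The type of `N z` depends on `z`; generalising the point avoids a dependent rewrite along
  -- `ψ.left_inv`.
  have h : ∀ z, z = y → comp φ (f z) (N z) i = comp φ (f y) (N y) i := by
    rintro _ rfl
    rfl
  exact h _ (ψ.left_inv hy)

variable [ChartedSpace (EuclideanSpace ℝ (Fin (d + 1))) S]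

lemma contDiffAt_embCoord (hφ : φ ∈ IsManifold.maximalAtlas (𝓡 m) ∞ M)
    (hψ : ψ ∈ IsManifold.maximalAtlas (𝓡 (d + 1)) ∞ S)
    (hsm : ContMDiff (𝓡 (d + 1)) (𝓡 m) ∞ f) (hy : y ∈ ψ.source) (hfy : f y ∈ φ.source)
    (i : Fin m) : ContDiffAt ℝ ∞ (embCoord φ ψ f i) (ψ y) := by
  have h1 : ContMDiffAt (𝓡 (d + 1)) (𝓡 (d + 1)) ∞ ψ.symm (ψ y) :=
    contMDiffAt_symm_of_mem_maximalAtlas hψ (ψ.map_source hy)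
  have h2 : ContMDiffAt (𝓡 m) (𝓡 m) ∞ φ (f (ψ.symm (ψ y))) := by
    rw [ψ.left_inv hy]
    exact contMDiffAt_of_mem_maximalAtlas hφ hfy
  have h3 := (h2.comp (ψ y) (hsm.contMDiffAt.comp (ψ y) h1)).contDiffAt
  exact contDiffAt_piLp 2 |>.mp h3 i

lemma comp_mfderiv (hφ : φ ∈ IsManifold.maximalAtlas (𝓡 m) ∞ M)
    (hψ : ψ ∈ IsManifold.maximalAtlas (𝓡 (d + 1)) ∞ S)
    (hsm : ContMDiff (𝓡 (d + 1)) (𝓡 m) ∞ f) (hy : y ∈ ψ.source) (hfy : f y ∈ φ.source)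
    (v : TangentSpace (𝓡 (d + 1)) y) :
    comp φ (f y) (mfderiv (𝓡 (d + 1)) (𝓡 m) f y v) =
      jac (embCoord φ ψ f) (ψ y) *ᵥ comp ψ y v := by
  ext i
  conv_lhs => rw [← sum_comp_smul_coordVec hψ hy v]
  simp only [map_sum, map_smul, comp_sum, comp_smul, comp_mfderiv_coordVec hφ hψ hsm hy hfy]
  exact Finset.sum_congr rfl fun _ _ => mul_comm _ _

end EmbeddingCharts

/-! ### The induced metric and the normal frame in charts. -/

section Submanifold

variable {m : ℕ} {M : Type*} [TopologicalSpace M] [ChartedSpace (EuclideanSpace ℝ (Fin m)) M]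
  [IsManifold (𝓡 m) ∞ M]
  {gbar : Bundle.ContMDiffRiemannianMetric (𝓡 m) ∞
      (EuclideanSpace ℝ (Fin m)) (fun y : M => TangentSpace (𝓡 m) y)}
  {φ : OpenPartialHomeomorph M (EuclideanSpace ℝ (Fin m))}

/-- A Riemannian metric at a point as a bilinear map. -/
def metricBilin (gbar : Bundle.ContMDiffRiemannianMetric (𝓡 m) ∞
      (EuclideanSpace ℝ (Fin m)) (fun y : M => TangentSpace (𝓡 m) y)) (y : M) :
    TangentSpace (𝓡 m) y →ₗ[ℝ] TangentSpace (𝓡 m) y →ₗ[ℝ] ℝ :=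
  LinearMap.mk₂ ℝ (fun v w => gbar.inner y v w) (fun _ _ _ => by simp) (fun _ _ _ => by simp)
    (fun _ _ _ => by simp) (fun _ _ _ => by simp)

lemma smoothMetricAt_metricInChart (hφ : φ ∈ IsManifold.maximalAtlas (𝓡 m) ∞ M)
    {u : EuclideanSpace ℝ (Fin m)} (hu : u ∈ φ.target) :
    SmoothMetricAt (metricInChart φ (fun y v w => gbar.inner y v w)) u where
  contDiffAt i j := contDiffAt_metricInChart gbar hφ hu i j
  symm := Eventually.of_forall fun _ _ _ => gbar.symm _ _ _
  isUnit_det := (det_gram_pos hφ (φ.map_target hu) (metricBilin gbar (φ.symm u))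
    (gbar.symm _) (gbar.pos _)).ne'.isUnit

variable {d : ℕ} {S : Type*} [TopologicalSpace S]
  {f : S → M} {ψ : OpenPartialHomeomorph S (EuclideanSpace ℝ (Fin (d + 1)))} {y : S}

lemma innerAlong_eq_inner (hφ : φ ∈ IsManifold.maximalAtlas (𝓡 m) ∞ M) (hy : y ∈ ψ.source)
    (hfy : f y ∈ φ.source) {ν τ : Fin m → EuclideanSpace ℝ (Fin (d + 1)) → ℝ}
    {v w : TangentSpace (𝓡 m) (f y)} (hv : ∀ i, ν i (ψ y) = comp φ (f y) v i)
    (hw : ∀ i, τ i (ψ y) = comp φ (f y) w i) :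
    innerAlong (metricInChart φ (fun y v w => gbar.inner y v w)) (embCoord φ ψ f) ν τ (ψ y) =
      gbar.inner (f y) v w := by
  have h := bilin_eq_sum hφ hfy (metricBilin gbar (f y)) v w
  change gbar.inner (f y) v w = _ at h
  rw [h, innerAlong]
  refine Finset.sum_congr rfl fun i _ => Finset.sum_congr rfl fun j _ => ?_
  rw [hv, hw, metricAlong, toLp_embCoord hy, metricInChart_apply _ hfy]
  rfl

variable [ChartedSpace (EuclideanSpace ℝ (Fin (d + 1))) S]

lemma metricInChart_inducedMetric (hφ : φ ∈ IsManifold.maximalAtlas (𝓡 m) ∞ M)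
    (hψ : ψ ∈ IsManifold.maximalAtlas (𝓡 (d + 1)) ∞ S)
    (hsm : ContMDiff (𝓡 (d + 1)) (𝓡 m) ∞ f) (hy : y ∈ ψ.source) (hfy : f y ∈ φ.source) :
    metricInChart ψ (inducedMetric (n := d + 1) f (fun y v w => gbar.inner y v w)) (ψ y) =
      pullbackMetric (metricInChart φ (fun y v w => gbar.inner y v w)) (embCoord φ ψ f) (ψ y) := by
  ext a b
  rw [metricInChart_apply _ hy, pullbackMetric_apply, inducedMetric]
  exact (innerAlong_eq_inner hφ hy hfy
    (fun i => (comp_mfderiv_coordVec hφ hψ hsm hy hfy i a).symm)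
    (fun i => (comp_mfderiv_coordVec hφ hψ hsm hy hfy i b).symm)).symm

/-- A positive form pulled back along the injective differential remains positive, so its Gram
determinant is positive. -/
lemma det_metricInChart_inducedMetric_pos (hf : Manifold.IsImmersion (𝓡 (d + 1)) (𝓡 m) ∞ f)
    (hsm : ContMDiff (𝓡 (d + 1)) (𝓡 m) ∞ f)
    (hψ : ψ ∈ IsManifold.maximalAtlas (𝓡 (d + 1)) ∞ S) (hy : y ∈ ψ.source) :
    0 < (metricInChart ψ (inducedMetric (n := d + 1) f
      (fun y v w => gbar.inner y v w)) (ψ y)).det := by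
  let D : TangentSpace (𝓡 (d + 1)) y →ₗ[ℝ] TangentSpace (𝓡 m) (f y) :=
    (mfderiv (𝓡 (d + 1)) (𝓡 m) f y).toLinearMap
  have hD : Function.Injective D := mfderiv_injective_of_isImmersion hf hsm y
  have h := det_gram_pos hψ hy ((metricBilin gbar (f y)).compl₁₂ D D)
    (fun v w => gbar.symm _ _ _)
    (fun v hv => gbar.pos _ _ fun h0 => hv (hD (h0.trans (map_zero D).symm)))
  convert h using 2
  ext a b
  rw [metricInChart_apply _ hy]
  rfl

lemma contDiffAt_alongCoord (hφ : φ ∈ IsManifold.maximalAtlas (𝓡 m) ∞ M)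
    (hψ : ψ ∈ IsManifold.maximalAtlas (𝓡 (d + 1)) ∞ S) (hy : y ∈ ψ.source)
    (hfy : f y ∈ φ.source) {N : (x : S) → TangentSpace (𝓡 m) (f x)}
    (hN : ContMDiffAt (𝓡 (d + 1)) (𝓡 m).tangent ∞
      (fun x => (⟨f x, N x⟩ : TangentBundle (𝓡 m) M)) y) (i : Fin m) :
    ContDiffAt ℝ ∞ (alongCoord φ ψ f N i) (ψ y) := by
  have h1 : ContMDiffAt (𝓡 (d + 1)) (𝓡 (d + 1)) ∞ ψ.symm (ψ y) :=
    contMDiffAt_symm_of_mem_maximalAtlas hψ (ψ.map_source hy)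
  refine contDiffAt_comp_of_contMDiffAt (h := fun u => f (ψ.symm u))
    (V := fun u => N (ψ.symm u)) hφ (by rwa [ψ.left_inv hy]) ?_ i
  exact ContMDiffAt.comp_of_eq hN h1 (ψ.left_inv hy)

end Submanifold

end NambuGeometry

end

/-! ### The Ricci map and the scalar curvature of the submanifold. -/

theorem mainTheorem1
    (d p : ℕ) (hd : 1 ≤ d)
    {M : Type*} [TopologicalSpace M] [ChartedSpace (EuclideanSpace ℝ (Fin (d + 1 + p))) M]
    [IsManifold (𝓡 (d + 1 + p)) ∞ M]
    (gbar : Bundle.ContMDiffRiemannianMetric (𝓡 (d + 1 + p)) ∞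
      (EuclideanSpace ℝ (Fin (d + 1 + p))) (fun y : M => TangentSpace (𝓡 (d + 1 + p)) y))
    {S : Type*} [TopologicalSpace S] [ChartedSpace (EuclideanSpace ℝ (Fin (d + 1))) S]
    [IsManifold (𝓡 (d + 1)) ∞ S]
    (f : S → M) (hf : Manifold.IsSmoothEmbedding (𝓡 (d + 1)) (𝓡 (d + 1 + p)) ∞ f)
    -- local coordinates on `M` and on `S`
    (φ : OpenPartialHomeomorph M (EuclideanSpace ℝ (Fin (d + 1 + p))))
    (hφ : φ ∈ IsManifold.maximalAtlas (𝓡 (d + 1 + p)) ∞ M)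
    (ψ : OpenPartialHomeomorph S (EuclideanSpace ℝ (Fin (d + 1))))
    (hψ : ψ ∈ IsManifold.maximalAtlas (𝓡 (d + 1)) ∞ S)
    -- a non-vanishing density, expressed in the coordinates `ψ`
    (ρ : S → ℝ) (hρ : ∀ x ∈ ψ.source, ρ x ≠ 0)
    -- a smooth orthonormal frame of the normal bundle over an open set `U`
    (U : Set S) (hU : IsOpen U)
    (N : Fin p → (x : S) → TangentSpace (𝓡 (d + 1 + p)) (f x))
    (hN : ∀ A, ContMDiffOn (𝓡 (d + 1)) (𝓡 (d + 1 + p)).tangent ∞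
      (fun x => (⟨f x, N A x⟩ : TangentBundle (𝓡 (d + 1 + p)) M)) U)
    (hNN : ∀ x ∈ U, ∀ A B, gbar.inner (f x) (N A x) (N B x) = if A = B then 1 else 0)
    (hNT : ∀ x ∈ U, ∀ A, ∀ v : TangentSpace (𝓡 (d + 1)) x,
      gbar.inner (f x) (N A x) (mfderiv (𝓡 (d + 1)) (𝓡 (d + 1 + p)) f x v) = 0)
    (x : S) (hxU : x ∈ U) (hxψ : x ∈ ψ.source) (hxφ : f x ∈ φ.source) :
    let g := NambuGeometry.inducedMetric (n := d + 1) f (fun y v w => gbar.inner y v w)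
    let G := NambuGeometry.metricInChart φ (fun y v w => gbar.inner y v w)
    let ρ' := fun u => ρ (ψ.symm u)
    let γ := √((NambuGeometry.metricInChart ψ g (ψ x)).det) / ρ x
    let P2 := NambuGeometry.tensorP2 G ρ' (NambuGeometry.embCoord φ ψ f) (ψ x)
    let Rbar := fun i j k l => NambuGeometry.riemann G i j k l (φ (f x))
    let B := fun A => NambuGeometry.mixedB G ρ' (NambuGeometry.embCoord φ ψ f)
      (NambuGeometry.alongCoord φ ψ f (N A)) (ψ x)
    let BMap := fun A => NambuGeometry.tangentEnd φ (f x) (B A)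
    let df := mfderiv (𝓡 (d + 1)) (𝓡 (d + 1 + p)) f x
    (∀ X : TangentSpace (𝓡 (d + 1)) x,
      df (NambuGeometry.ricciMap ψ g x X) =
        (1 / γ ^ 4) • (∑ i, ∑ j, ∑ k, ∑ l, ∑ r,
            (P2 i k * P2 l r * Rbar i j k l * NambuGeometry.comp φ (f x) (df X) j) •
              NambuGeometry.coordVec φ (f x) r)
          + (1 / γ ^ 4) • ∑ A, ((B A).trace • BMap A (df X) - BMap A (BMap A (df X)))) ∧
    NambuGeometry.scalarCurvature ψ g x =
      (1 / γ ^ 4) * (∑ i, ∑ j, ∑ k, ∑ l, P2 i k * P2 j l * Rbar i j k l)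
        + (1 / γ ^ 4) * ∑ A, ((B A).trace ^ 2 - (B A ^ 2).trace) := by
  intro g G ρ' γ P2 Rbar B BMap df
  have hsm : ContMDiff (𝓡 (d + 1)) (𝓡 (d + 1 + p)) ∞ f := hf.isImmersion.contMDiff
  set X := NambuGeometry.embCoord φ ψ f with hX
  have hev : ∀ᶠ v in nhds (ψ x), v ∈ ψ.target ∧ ψ.symm v ∈ U ∧ f (ψ.symm v) ∈ φ.source := by
    have h1 : ContinuousAt ψ.symm (ψ x) := ψ.continuousAt_symm (ψ.map_source hxψ)
    have h2 : Filter.Tendsto ψ.symm (nhds (ψ x)) (nhds x) := by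
      have := h1.tendsto
      rwa [ψ.left_inv hxψ] at this
    have h3 : Filter.Tendsto (fun v => f (ψ.symm v)) (nhds (ψ x)) (nhds (f x)) :=
      hsm.continuous.continuousAt.tendsto.comp h2
    filter_upwards [ψ.open_target.mem_nhds (ψ.map_source hxψ), h2 (hU.mem_nhds hxU),
      h3 (φ.open_source.mem_nhds hxφ)] with v hv1 hv2 hv3
    exact ⟨hv1, hv2, hv3⟩
  -- Pointwise statements on the submanifold become statements near `ψ x`, the form in which the
  -- coordinate theorems take their hypotheses.
  have hloc : ∀ {P : EuclideanSpace ℝ (Fin (d + 1)) → Prop},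
      (∀ y ∈ ψ.source, y ∈ U → f y ∈ φ.source → P (ψ y)) → ∀ᶠ v in nhds (ψ x), P v := by
    intro P hP
    filter_upwards [hev] with v hv
    have := hP _ (ψ.map_target hv.1) hv.2.1 hv.2.2
    rwa [ψ.right_inv hv.1] at this
  have hXs : ∀ᶠ v in nhds (ψ x), ∀ i, ContDiffAt ℝ ∞ (X i) v :=
    hloc fun y hy _ hfy i => NambuGeometry.contDiffAt_embCoord hφ hψ hsm hy hfy i
  have hG : ∀ᶠ v in nhds (ψ x), NambuGeometry.SmoothMetricAt G (WithLp.toLp 2 fun i => X i v) := by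
    refine hloc fun y hy _ hfy => ?_
    rw [hX, NambuGeometry.toLp_embCoord hy]
    exact NambuGeometry.smoothMetricAt_metricInChart hφ (φ.map_source hfy)
  have hgg : ∀ᶠ v in nhds (ψ x), NambuGeometry.metricInChart ψ g v =
      NambuGeometry.pullbackMetric G X v :=
    hloc fun y hy _ hfy => NambuGeometry.metricInChart_inducedMetric hφ hψ hsm hy hfy
  have hpos : 0 < (NambuGeometry.metricInChart ψ g (ψ x)).det :=
    NambuGeometry.det_metricInChart_inducedMetric_pos hf.isImmersion hsm hψ hxψ
  have hg : ∀ᶠ v in nhds (ψ x), IsUnit (NambuGeometry.pullbackMetric G X v).det := by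
    refine hloc fun y hy _ hfy => ?_
    rw [← NambuGeometry.metricInChart_inducedMetric hφ hψ hsm hy hfy]
    exact (NambuGeometry.det_metricInChart_inducedMetric_pos hf.isImmersion hsm hψ hy).ne'.isUnit
  have hν : ∀ A i, ContDiffAt ℝ ∞ (NambuGeometry.alongCoord φ ψ f (N A) i) (ψ x) := fun A i =>
    NambuGeometry.contDiffAt_alongCoord hφ hψ hxψ hxφ
      ((hN A).contMDiffAt (hU.mem_nhds hxU)) i
  have hνν : ∀ A A', NambuGeometry.innerAlong G X (NambuGeometry.alongCoord φ ψ f (N A))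
      (NambuGeometry.alongCoord φ ψ f (N A')) (ψ x) = if A = A' then 1 else 0 := by
    intro A A'
    rw [← hNN x hxU A A']
    exact NambuGeometry.innerAlong_eq_inner hφ hxψ hxφ
      (NambuGeometry.alongCoord_apply _ hxψ) (NambuGeometry.alongCoord_apply _ hxψ)
  have hνT : ∀ᶠ v in nhds (ψ x), ∀ A a, NambuGeometry.innerAlong G X
      (NambuGeometry.alongCoord φ ψ f (N A)) (NambuGeometry.tangentAlong X a) v = 0 := by
    refine hloc fun y hy hyU hfy A a => ?_
    rw [← hNT y hyU A (NambuGeometry.coordVec ψ y a)]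
    exact NambuGeometry.innerAlong_eq_inner hφ hy hfy (NambuGeometry.alongCoord_apply _ hy)
      (fun i => (NambuGeometry.comp_mfderiv_coordVec hφ hψ hsm hy hfy i a).symm)
  have hρx : ρ' (ψ x) = ρ x := congrArg ρ (ψ.left_inv hxψ)
  have hρ0 : ρ' (ψ x) ≠ 0 := by rw [hρx]; exact hρ x hxψ
  -- The square root squares back to the determinant because the latter is nonnegative.
  have hγ : γ ^ 4 = ((NambuGeometry.pullbackMetric G X (ψ x)).det / ρ' (ψ x) ^ 2) ^ 2 := by
    change (√((NambuGeometry.metricInChart ψ g (ψ x)).det) / ρ x) ^ (2 * 2) = _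
    rw [hρx, ← hgg.self_of_nhds, pow_mul, div_pow, Real.sq_sqrt hpos.le]
  have hpt : (WithLp.toLp 2 fun i => X i (ψ x)) = φ (f x) := NambuGeometry.toLp_embCoord hxψ
  have hric := NambuGeometry.ricciMatrix_congr hgg
  constructor
  · intro v
    have hmain := NambuGeometry.jac_mul_ricciMatrix (ρ := ρ') rfl hXs hG hg hν hνν hνT hρ0
    rw [← hric, ← hγ, hpt] at hmain
    -- Equality of tangent vectors is checked on components in `φ`, where `df` acts as the Jacobian
    -- and the Ricci map as its matrix.
    refine NambuGeometry.comp_ext hφ hxφ fun r => ?_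
    rw [NambuGeometry.comp_mfderiv hφ hψ hsm hxψ hxφ]
    have h1 : NambuGeometry.comp ψ x (NambuGeometry.ricciMap ψ g x v) =
        (NambuGeometry.ricciMatrix (NambuGeometry.metricInChart ψ g) (ψ x)).mulVec
          (NambuGeometry.comp ψ x v) :=
      funext fun a => NambuGeometry.comp_tangentEnd hψ hxψ _ _ a
    rw [h1, Matrix.mulVec_mulVec, hmain, ← Matrix.mulVec_mulVec,
      ← NambuGeometry.comp_mfderiv hφ hψ hsm hxψ hxφ, NambuGeometry.comp_add,
      NambuGeometry.comp_smul, NambuGeometry.comp_smul,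
      NambuGeometry.comp_sum_smul_coordVec hφ hxφ P2 Rbar (df v) r,
      NambuGeometry.comp_sum, Matrix.smul_mulVec, Pi.smul_apply, smul_eq_mul, Matrix.add_mulVec,
      Pi.add_apply, mul_add]
    congr 2
    rw [Matrix.sum_mulVec, Finset.sum_apply]
    refine Finset.sum_congr rfl fun A _ => ?_
    have h2 : ∀ w, NambuGeometry.comp φ (f x) (BMap A w) =
        (B A).mulVec (NambuGeometry.comp φ (f x) w) :=
      fun w => funext fun i => NambuGeometry.comp_tangentEnd hφ hxφ _ _ i
    rw [NambuGeometry.comp_sub, NambuGeometry.comp_smul, h2, h2, h2, Matrix.sub_mulVec,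
      Matrix.mulVec_mulVec, Matrix.smul_mulVec]
    rfl
  · have hmain := NambuGeometry.trace_ricciMatrix (ρ := ρ') rfl hXs hG hg hν hνν hνT hρ0
    rw [← hric, ← hγ, hpt, mul_add] at hmain
    exact hmain
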